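/- Conventions. An algorithm is a deterministic multi-stack (equivalently, multi-tape) Turing machine over the binary alphabet; it works in space $s$ on an input if it halts and at every moment occupies at most $s$ memory cells beyond those taken by the input. Parameters are tuples $p=(n,m,d,k)$, given to every algorithm in unary; $N=2^n$, $M=2^m$, $D=2^d$, $K=2^k$. Fix a constant $a$ and a polynomial $b$, and let $P$ be any set of parameter tuples with $k<n$ and $m,d\le b(n)$. For every $p\in P$ let $G=G_p$ be a bipartite multigraph with left part $\{0,1\}^n$, right part $\{0,1\}^m$ and $D$ edges from each left vertex, and let $\mathcal S=\mathcal S_p$ be a relevant system, i.e. a system of at most $2^{an}$ subsets of $\{0,1\}^n$, each with fewer than $2^k$ elements. The family $\mathcal S$ is enumerable in space $s=s(p)$ if its members can be numbered, possibly with repetitions, by at most $2^{an}$ indices, and the elements of each member listed without repetition, in such a way that one algorithm, given $p\in P$ and $i,j\in\mathbb N$ in binary, works in space $s(p)$ and either outputs the $j$th element of the $i$th set or indicates that at least one of $i,j$ is out of range. The family $G$ is computable in space $q=q(p)$ if one algorithm, given $p\in P$, a left vertex and the index of an edge from it, outputs in space $q(p)$ the right vertex this edge leads to. For $S\subset\{0,1\}^n$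 the $\alpha$-clot of $S$ is the set of right vertices that receive more than $\alpha DK/M$ edges from $S$; a vertex $x\in S$ is $\alpha$-congested for $S$ if all its neighbours lie in the $\alpha$-clot of $S$; and $\mathrm{Con}_\alpha\mathcal S$ is the system of all sets $T$ such that, for some $S\in\mathcal S$, $T$ is the set of vertices $\alpha$-congested for $S$. Lemma. For every rational $\alpha>1$, every $a$ and every $b$ there are a constant $c$ and a polynomial $f$ such that for all $P,\mathcal S,G,s,q$ as above the following holds. If $\mathcal S$ is enumerable in space $s$ and $G$ is computable in space $q$, then $\mathrm{Con}_\alpha\mathcal S$ is enumerable in space $c\cdot\max\{s,q\}+f(n)$. Moreover, for every $r\in\mathbb N$ the iterate $(\mathrm{Con}_\alpha)^r\mathcal S$ (with the same $G$ and $K$) is enumerable in space $c\cdot\max\{s,q\}+f(n)$, with the same $c$ and $f$ for all $r$. -/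

import Mathlib

namespace CongestedEnum

/-! ### Algorithms and their space -/

/-- A deterministic multi-stack Turing machine (Mathlib's `TM2` model) with finitely many stacks of
bits, finitely many labels and finitely many internal states. The stacks `Sum.inl t` hold the `a`
input strings at the start; the stacks indexed by `W` are work stacks, initially empty. (A two-sided
tape is a pair of stacks, so this is the multi-tape Turing machine.) -/
structure Machine (a : ℕ) where
  W : Type
  Λ : Type
  σ : Type
  [decW : DecidableEq W]
  [finW : Fintype W]
  [finΛ : Fintype Λ]
  [finσ : Fintype σ]
  start : Λ
  init : σ
  code : Λ → Turing.TM2.Stmt (fun _ : Fin a ⊕ W => Bool) Λ σ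
  out : Fin a ⊕ W

attribute [instance] Machine.decW Machine.finW Machine.finΛ Machine.finσ

namespace Machine

variable {a : ℕ}

abbrev Cfg (T : Machine a) : Type :=
  Turing.TM2.Cfg (fun _ : Fin a ⊕ T.W => Bool) T.Λ T.σ

/-- The initial configuration on the given input strings. -/
def initCfg (T : Machine a) (input : Fin a → List Bool) : T.Cfg where
  l := some T.start
  var := T.init
  stk := Sum.elim input (fun _ => [])

/-- The number of memory cells in use in a configuration. -/
def cells (T : Machine a) (c : T.Cfg) : ℕ := ∑ k, (c.stk k).length

/-- On `input`, the machine halts with `output` on its output stack, and at every moment of the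
computation it occupies at most `s` cells beyond those that the input itself takes. -/
def ComputesInSpace (T : Machine a) (input : Fin a → List Bool) (output : List Bool) (s : ℕ) :
    Prop :=
  (∃ c : T.Cfg, Turing.TM2.Reaches T.code (T.initCfg input) c ∧ c.l = none ∧
      c.stk T.out = output) ∧
    ∀ c : T.Cfg, Turing.TM2.Reaches T.code (T.initCfg input) c →
      T.cells c ≤ (∑ t, (input t).length) + s

end Machine

/-! ### Parameters, graphs and systems of sets -/

/-- `n`, `m`, `d`: lengths of left vertices, right vertices and edge indices; `k`: the logarithm of
the size bound `K`. -/
structure Params where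
  n : ℕ
  m : ℕ
  d : ℕ
  k : ℕ

/-- Bit strings of length `n`. -/
abbrev Str (n : ℕ) : Type := Fin n → Bool

/-- A bipartite multigraph with left part `{0,1}ⁿ`, right part `{0,1}ᵐ` and `2ᵈ` edges from each left
vertex: the edge number `e` of `x` leads to `G x e`. -/
abbrev Graph (p : Params) : Type := Str p.n → Str p.d → Str p.m

/-- A system of subsets of the left part. -/
abbrev SetSystem (p : Params) : Type := Set (Finset (Str p.n))

/-- `y` lies in the `α`-clot for `S`: it receives more than `α * D * K / M` edges from `S`, where
`D = 2 ^ d`, `K = 2 ^ k`, `M = 2 ^ m`. -/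
def InClot {p : Params} (α : ℚ) (G : Graph p) (S : Finset (Str p.n)) (y : Str p.m) : Prop :=
  α * 2 ^ p.d * 2 ^ p.k / 2 ^ p.m <
    (((S ×ˢ (Finset.univ : Finset (Str p.d))).filter fun xe => G xe.1 xe.2 = y).card : ℚ)

open Classical in
/-- The set of `α`-congested vertices of `S`: all their neighbours lie in the `α`-clot for `S`. -/
noncomputable def congested {p : Params} (α : ℚ) (G : Graph p) (S : Finset (Str p.n)) :
    Finset (Str p.n) :=
  S.filter fun x => ∀ e, InClot α G S (G x e)

/-- The system `Con_α 𝒮`. -/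
def Con {p : Params} (α : ℚ) (G : Graph p) (𝒮 : SetSystem p) : SetSystem p :=
  {T | ∃ S ∈ 𝒮, T = congested α G S}

/-! ### Families indexed by a set `P` of admissible parameters -/

/-- The standing assumptions on the parameters: `k < n`, and `m`, `d` are polynomially bounded
in `n`. -/
def Admissible (b : Polynomial ℕ) (P : Set Params) : Prop :=
  ∀ p ∈ P, p.k < p.n ∧ p.m ≤ b.eval p.n ∧ p.d ≤ b.eval p.n

/-- A family of relevant systems: sets of fewer than `2 ^ k` vertices, at most `2 ^ (a * n)` sets. -/
def Relevant (a : ℕ) (P : Set Params) (𝒮 : ∀ p, SetSystem p) : Prop :=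
  ∀ p ∈ P, (∀ S ∈ 𝒮 p, S.card < 2 ^ p.k) ∧ (𝒮 p).ncard ≤ 2 ^ (a * p.n)

/-- The input of an algorithm: the parameters in unary, and two strings. -/
def inputs (p : Params) (u v : List Bool) : Fin 6 → List Bool :=
  ![List.replicate p.n true, List.replicate p.m true, List.replicate p.d true,
    List.replicate p.k true, u, v]

/-- The answer `none` (an index is out of range) is the empty string, the answer `some x` is the
string `x` preceded by the bit `1`. -/
def encodeAnswer {n : ℕ} : Option (Str n) → List Bool
  | none => []
  | some x => true :: List.ofFn x

/-- One algorithm which, on the parameters `p ∈ P` and two indices `i`, `j` in binary, outputs the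
`j`-th element of the `i`-th set of `𝒮 p` or says that an index is out of range, in space `s p`.
The list `L` is the numbering of the system (a set may occur several times in it, but there are at
most `2 ^ (a * n)` indices), each set being listed without repetitions. -/
def EnumerableInSpace (a : ℕ) (P : Set Params) (𝒮 : ∀ p, SetSystem p) (s : Params → ℕ) : Prop :=
  ∃ T : Machine 6, ∀ p ∈ P, ∃ L : List (List (Str p.n)),
    L.length ≤ 2 ^ (a * p.n) ∧
    (∀ l ∈ L, l.Nodup) ∧
    𝒮 p = {S | ∃ l ∈ L, S = l.toFinset} ∧
    ∀ i j : ℕ, T.ComputesInSpace (inputs p (Nat.bits i) (Nat.bits j))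
      (encodeAnswer (L[i]?.bind fun l => l[j]?)) (s p)

/-- One algorithm which, on the parameters `p ∈ P`, a left vertex `x` and an edge index `e`, outputs
the right vertex to which this edge leads, in space `q p`. -/
def ComputableInSpace (P : Set Params) (G : ∀ p, Graph p) (q : Params → ℕ) : Prop :=
  ∃ T : Machine 6, ∀ p ∈ P, ∀ (x : Str p.n) (e : Str p.d),
    T.ComputesInSpace (inputs p (List.ofFn x) (List.ofFn e)) (List.ofFn (G p x e)) (q p)

end CongestedEnum

/-! An element of the set derived from $S$ is recognised by recomputation. Suppose $S$ is listed by
a duplicate-free list `l`. A right vertex $y$ lies in the clot exactly when the number of edges from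
`l` to $y$ exceeds the integer $\lfloor\alpha DK/M\rfloor$, because edge counts are integers. This
number is found by running through the elements of `l` and all edge indices, asking the two given
machines for each element and each edge and keeping only a binary counter. So the congested elements
of `l` are `l` filtered by a decidable test, and the $j$th of them is found by scanning `l` and
counting hits. The answers of the machines are never stored beyond the current ones, and their
stacks are emptied after each call. One application of `Con` therefore costs $\max\{s,q\}$ plus an
overhead `stepSpace` linear in $n+m+d+k$ and the index length (`EnumerableBelow.con`).

Nesting $r$ such algorithms costs $\max\{s,q\}+r\cdot$`stepSpace`, since $s$ and $q$ enter only
once, through the maximum (`EnumerableBelow.iterate_con`). To get a polynomial independent of $r$,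
note that the algorithm may depend on $r$. If $n\ge r$, the overhead is at most $n\cdot$`stepSpace`,
a polynomial in $n$. If $n<r$, then $k<n$ and $m,d\le b(n)$ leave finitely many parameter tuples,
and all answers for them are built into the finite control.

One obstacle is that indices are arbitrary, while passing them to an inner machine requires copying
them. Since there are at most $2^{an}$ lists, each shorter than $2^k<2^n$, an index with more than
$(a+1)n$ digits is out of range. The length is checked first against a unary budget (`atMost`),
without copying the index, and the nested algorithms handle short indices only
(`EnumerableBelow.enumerableInSpace`).

The programs are verified in a calculus of weakest preconditions `wp` that yields termination,
output and the space bound together. It is connected to the machines by `wp_ofMachine` and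
`computesInSpace_toMachine`. -/

open Function

namespace CongestedEnum

/-! ### Program fragments

A fragment is a finite program over stacks of bits indexed by `K` with exits in `E`. -/

/-- A finite sequence of stack operations, with branching on the popped symbols, that leads to a
point in `X`. -/
inductive Instr (K X : Type) : Type
  | goto : X → Instr K X
  | push : K → Bool → Instr K X → Instr K X
  | pop : K → (Option Bool → Instr K X) → Instr K X

namespace Instr

variable {K K' X Y : Type}

def exec [DecidableEq K] : Instr K X → (K → List Bool) → X × (K → List Bool)
  | goto x, S => (x, S)
  | push k b I, S => I.exec (update S k (b :: S k))
  | pop k f, S => (f (S k).head?).exec (update S k (S k).tail)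

def map (g : K → K') (f : X → Y) : Instr K X → Instr K' Y
  | goto x => goto (f x)
  | push k b I => push (g k) b (I.map g f)
  | pop k h => pop (g k) fun o => (h o).map g f

theorem update_extend [DecidableEq K] [DecidableEq K'] {g : K → K'} (hg : Injective g)
    (S : K → List Bool) (S₀ : K' → List Bool) (k : K) (v : List Bool) :
    update (extend g S S₀) (g k) v = extend g (update S k v) S₀ := by
  funext k'
  by_cases h : ∃ j, g j = k'
  · obtain ⟨j, rfl⟩ := h
    rw [hg.extend_apply]
    by_cases hj : j = k
    · subst hj; simp
    · rw [update_of_ne (fun h => hj (hg h)), update_of_ne hj, hg.extend_apply]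
  · rw [extend_apply' _ _ _ h, update_of_ne, extend_apply' _ _ _ h]
    rintro rfl
    exact h ⟨k, rfl⟩

/-- `extend g S S₀` describes a small memory `S` placed inside a larger one whose other stacks hold
`S₀`. Injectivity of `g` excludes aliasing, so the embedded instruction leaves the other stacks
untouched. -/
theorem exec_map [DecidableEq K] [DecidableEq K'] {g : K → K'} (hg : Injective g) (f : X → Y)
    (I : Instr K X) (S : K → List Bool) (S₀ : K' → List Bool) :
    (I.map g f).exec (extend g S S₀) = (f (I.exec S).1, extend g (I.exec S).2 S₀) := by
  induction I generalizing S with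
  | goto x => rfl
  | push k b I ih =>
    simp only [map, exec]
    rw [hg.extend_apply, update_extend hg, ih]
  | pop k h ih =>
    simp only [map, exec]
    rw [hg.extend_apply, update_extend hg, ih]

theorem exec_map_id [DecidableEq K] (f : X → Y) (I : Instr K X) (S : K → List Bool) :
    (I.map id f).exec S = (f (I.exec S).1, (I.exec S).2) := by
  have := exec_map injective_id f I S S
  simpa only [extend_id] using this

end Instr

/-- A finite flow graph. The start may itself be an exit, so that trivial programs take no step. -/
structure Frag (K E : Type) where
  Q : Type
  [fin : Finite Q]
  start : Q ⊕ E
  code : Q → Instr K (Q ⊕ E)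

attribute [instance] Frag.fin

/-- The total number of symbols on the stacks. -/
def cells {K : Type} [Fintype K] (S : K → List Bool) : ℕ := ∑ k, (S k).length

theorem cells_update {K : Type} [Fintype K] [DecidableEq K] (S : K → List Bool) (k : K)
    (v : List Bool) : cells (update S k v) + (S k).length = cells S + v.length := by
  unfold cells
  rw [← Finset.add_sum_erase _ _ (Finset.mem_univ k),
    ← Finset.add_sum_erase Finset.univ (fun j => (S j).length) (Finset.mem_univ k)]
  rw [Finset.sum_congr rfl (g := fun j => (S j).length)]
  · simp; omega
  · intro j hj
    rw [update_of_ne (Finset.ne_of_mem_erase hj)]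

/-- Only an inequality, because what `S₀` holds on the range of `g` is overwritten. -/
theorem cells_extend_le {K K' : Type} [Fintype K] [Fintype K'] {g : K → K'}
    (hg : Injective g) (S : K → List Bool) (S₀ : K' → List Bool) :
    cells (extend g S S₀) ≤ cells S + cells S₀ := by
  classical
  unfold cells
  have : ∑ k, (S k).length = ∑ k', if h : ∃ k, g k = k' then (S h.choose).length else 0 := by
    rw [← Finset.sum_subset (Finset.subset_univ (Finset.univ.image g)),
      Finset.sum_image (fun x _ y _ h => hg h)]
    · refine Finset.sum_congr rfl fun k _ => ?_
      have h : ∃ j, g j = g k := ⟨k, rfl⟩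
      rw [dif_pos h, hg h.choose_spec]
    · intro x _ hx
      rw [dif_neg]
      simpa using hx
  rw [this, ← Finset.sum_add_distrib]
  refine Finset.sum_le_sum fun k' _ => ?_
  rw [Function.extend_def]
  split_ifs <;> simp

namespace Frag

variable {K K' E E' : Type} [DecidableEq K] [Fintype K] [DecidableEq K'] [Fintype K']

/-- The run from the point `x` with stacks `S` reaches an exit with `post`, and has at most `B`
symbols on the stacks before each step. -/
inductive Ends (F : Frag K E) (B : ℕ) (post : E → (K → List Bool) → Prop) :
    F.Q ⊕ E → (K → List Bool) → Prop
  | done (e S) : post e S → Ends F B post (Sum.inr e) S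
  | step (q S) : cells S ≤ B → Ends F B post ((F.code q).exec S).1 ((F.code q).exec S).2 →
      Ends F B post (Sum.inl q) S

/-- The weakest precondition of `F` for `post` within `B` cells. -/
def wp (F : Frag K E) (B : ℕ) (S : K → List Bool) (post : E → (K → List Bool) → Prop) : Prop :=
  F.Ends B post F.start S

theorem Ends.mono {F : Frag K E} {B : ℕ} {P R : E → (K → List Bool) → Prop} {x S}
    (h : F.Ends B P x S) (hPR : ∀ e S, P e S → R e S) : F.Ends B R x S := by
  induction h with
  | done e S h => exact .done e S (hPR _ _ h)
  | step q S hc _ ih => exact .step q S hc ih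

theorem wp.mono {F : Frag K E} {B : ℕ} {P R : E → (K → List Bool) → Prop} {S}
    (h : F.wp B S P) (hPR : ∀ e S, P e S → R e S) : F.wp B S R :=
  Ends.mono h hPR

protected def pure (e : E) : Frag K E where
  Q := Empty
  start := Sum.inr e
  code := Empty.elim

theorem wp_pure {e : E} {B : ℕ} {S : K → List Bool} {post} (h : post e S) :
    (Frag.pure (K := K) e).wp B S post := .done e S h

/-- A fragment with one point, given by one instruction, where `none` is the point itself. -/
def single (I : Instr K (Unit ⊕ E)) : Frag K E where
  Q := Unit
  start := Sum.inl ()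
  code := fun _ => I

def bindInr (G : E → Frag K E') (Q : Type) (e : E) :
    (G e).Q ⊕ E' → (Q ⊕ Σ e, (G e).Q) ⊕ E' :=
  Sum.map (fun q => Sum.inr ⟨e, q⟩) id

def bindGlue (F : Frag K E) (G : E → Frag K E') : F.Q ⊕ E → (F.Q ⊕ Σ e, (G e).Q) ⊕ E' :=
  Sum.elim (fun q => Sum.inl (Sum.inl q)) (fun e => bindInr G F.Q e (G e).start)

protected def bind [Finite E] (F : Frag K E) (G : E → Frag K E') : Frag K E' where
  Q := F.Q ⊕ Σ e, (G e).Q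
  start := bindGlue F G F.start
  code := Sum.elim (fun q => (F.code q).map id (bindGlue F G))
    (fun q => ((G q.1).code q.2).map id (bindInr G F.Q q.1))

/-- Both pieces run under the same bound `B`: consecutive programs reuse space instead of adding it.
-/
theorem wp_bind [Finite E] {F : Frag K E} {G : E → Frag K E'} {B : ℕ} {S : K → List Bool}
    {post : E' → (K → List Bool) → Prop}
    (h : F.wp B S fun e S' => (G e).wp B S' post) : (F.bind G).wp B S post := by
  have key : ∀ e x S, (G e).Ends B post x S → (F.bind G).Ends B post (bindInr G F.Q e x) S := by
    intro e x S h
    induction h with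
    | done e S h => exact .done _ _ h
    | step q S hc _ ih =>
      refine .step _ _ hc ?_
      simpa only [Frag.bind, Sum.elim_inr, Instr.exec_map_id] using ih
  have key2 : ∀ x S, F.Ends B (fun e S' => (G e).wp B S' post) x S →
      (F.bind G).Ends B post (bindGlue F G x) S := by
    intro x S h
    induction h with
    | done e S h => exact key _ _ _ h
    | step q S hc _ ih =>
      refine .step _ _ hc ?_
      simpa only [Frag.bind, Sum.elim_inl, Instr.exec_map_id] using ih
  exact key2 _ _ h

def loopGlue (F : Frag K (Option E)) : F.Q ⊕ Option E → Option F.Q ⊕ E :=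
  Sum.elim (fun q => Sum.inl (some q)) (fun o => o.elim (Sum.inl none) Sum.inr)

/-- Repeat `F` until it exits with a value. -/
def loop (F : Frag K (Option E)) : Frag K E where
  Q := Option F.Q
  start := Sum.inl none
  code := fun o => o.elim (.goto (loopGlue F F.start)) (fun q => (F.code q).map id (loopGlue F))

/-- Unfolds a single round. As `Ends` is inductive, termination has to be proved at each use, by
induction on the number of rounds left. The bound on `cells S` pays for the step taken at the loop
head. -/
theorem wp_loop {F : Frag K (Option E)} {B : ℕ} {S : K → List Bool}
    {post : E → (K → List Bool) → Prop} (hc : cells S ≤ B)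
    (h : F.wp B S fun o S' => o.elim (F.loop.wp B S' post) (fun e => post e S')) :
    F.loop.wp B S post := by
  have key : ∀ x S, F.Ends B (fun o S' => o.elim (F.loop.wp B S' post) (fun e => post e S')) x S →
      F.loop.Ends B post (loopGlue F x) S := by
    intro x S h
    induction h with
    | done e S h => cases e with
      | none => exact h
      | some e => exact .done _ _ h
    | step q S hc _ ih =>
      refine .step _ _ hc ?_
      simpa only [loop, Option.elim_some, Instr.exec_map_id] using ih
  exact .step _ _ hc (key _ _ h)

/-- The fragment on more stacks. -/
def rename (g : K → K') (F : Frag K E) : Frag K' E where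
  Q := F.Q
  start := F.start
  code := fun q => (F.code q).map g id

theorem wp_rename {g : K → K'} (hg : Injective g) {F : Frag K E} {B : ℕ} {S : K → List Bool}
    {S₀ : K' → List Bool} {post : E → (K → List Bool) → Prop} (h : F.wp B S post) :
    (F.rename g).wp (B + cells S₀) (extend g S S₀)
      fun e T => ∃ S', post e S' ∧ T = extend g S' S₀ := by
  have key : ∀ x S, F.Ends B post x S → (F.rename g).Ends (B + cells S₀)
      (fun e T => ∃ S', post e S' ∧ T = extend g S' S₀) x (extend g S S₀) := by
    intro x S h
    induction h with
    | done e S h => exact .done _ _ ⟨S, h, rfl⟩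
    | step q S hc _ ih =>
      refine .step _ _ ((cells_extend_le hg _ _).trans (by omega)) ?_
      simpa only [rename, Instr.exec_map hg, id] using ih
  exact key _ _ h

theorem Ends.mono_bound {F : Frag K E} {B B' : ℕ} {P : E → (K → List Bool) → Prop} {x S}
    (h : F.Ends B P x S) (hB : B ≤ B') : F.Ends B' P x S := by
  induction h with
  | done e S h => exact .done e S h
  | step q S hc _ ih => exact .step q S (hc.trans hB) ih

theorem wp.mono_bound {F : Frag K E} {B B' : ℕ} {P : E → (K → List Bool) → Prop} {S}
    (h : F.wp B S P) (hB : B ≤ B') : F.wp B' S P :=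
  Ends.mono_bound h hB

end Frag

/-! ### Fragments and machines -/

section ofMachine

open Turing.TM2 (Stmt Cfg)

variable {K Λ σ : Type}

/-- The internal state is a parameter, so it becomes part of the finite control; a `peek` is a pop
followed by pushing the symbol back. -/
def Instr.ofStmt : Stmt (fun _ : K => Bool) Λ σ → σ → Instr K ((Λ × σ) ⊕ Unit)
  | .push k f q, v => .push k (f v) (ofStmt q v)
  | .peek k f q, v => .pop k fun o => o.elim (ofStmt q (f v o)) fun b => .push k b (ofStmt q (f v o))
  | .pop k f q, v => .pop k fun o => ofStmt q (f v o)
  | .load f q, v => ofStmt q (f v)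
  | .branch f q₁ q₂, v => cond (f v) (ofStmt q₁ v) (ofStmt q₂ v)
  | .goto f, v => .goto (Sum.inl (f v, v))
  | .halt, _ => .goto (Sum.inr ())

/-- The point of the fragment that corresponds to a configuration. -/
def pointOfCfg (c : Cfg (fun _ : K => Bool) Λ σ) : (Λ × σ) ⊕ Unit :=
  c.l.elim (Sum.inr ()) fun l => Sum.inl (l, c.var)

theorem Instr.exec_ofStmt [DecidableEq K] (q : Stmt (fun _ : K => Bool) Λ σ) (v : σ)
    (S : K → List Bool) :
    (ofStmt q v).exec S =
      (pointOfCfg (Turing.TM2.stepAux q v S), (Turing.TM2.stepAux q v S).stk) := by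
  induction q generalizing v S with
  | push k f q ih => simp [ofStmt, exec, ih]
  | peek k f q ih =>
    cases h : S k with
    | nil =>
      have : update S k [] = S := by rw [← h, update_eq_self]
      simp [ofStmt, exec, ih, h, this]
    | cons b l =>
      have : update S k (b :: l) = S := by rw [← h, update_eq_self]
      simp [ofStmt, exec, ih, h, this]
  | pop k f q ih => simp [ofStmt, exec, ih]
  | load f q ih => simp [ofStmt, ih]
  | branch f q₁ q₂ ih₁ ih₂ => cases h : f v <;> simp [ofStmt, h, ih₁, ih₂]
  | goto f => rfl
  | halt => rfl

namespace Frag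

def ofMachine {a : ℕ} (T : Machine a) : Frag (Fin a ⊕ T.W) Unit where
  Q := T.Λ × T.σ
  start := Sum.inl (T.start, T.init)
  code := fun q => Instr.ofStmt (T.code q.1) q.2

/-- Backward induction along the halting run. The space bound concerns all reachable configurations,
hence it is inherited by every later part of the run. -/
theorem wp_ofMachine {a : ℕ} {T : Machine a} {input : Fin a → List Bool} {output : List Bool}
    {s : ℕ} (h : T.ComputesInSpace input output s) :
    (ofMachine T).wp (∑ t, (input t).length + s) (Sum.elim input fun _ => [])
      fun _ S => S T.out = output ∧ cells S ≤ ∑ t, (input t).length + s := by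
  obtain ⟨⟨c, hc, hl, ho⟩, hs⟩ := h
  have key : ∀ c' : T.Cfg, Turing.TM2.Reaches T.code c' c →
      (∀ c'', Turing.TM2.Reaches T.code c' c'' → T.cells c'' ≤ (∑ t, (input t).length) + s) →
      (ofMachine T).Ends (∑ t, (input t).length + s)
        (fun _ S => S T.out = output ∧ cells S ≤ ∑ t, (input t).length + s)
        (pointOfCfg c') c'.stk := by
    intro c' hr
    induction hr using Relation.ReflTransGen.head_induction_on with
    | refl =>
      intro hs
      have : pointOfCfg c = Sum.inr () := by simp [pointOfCfg, hl]
      rw [this]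
      exact .done _ _ ⟨ho, hs c .refl⟩
    | head hab hbc ih =>
      rename_i x y
      intro hs
      obtain ⟨l, v, S⟩ := x
      cases l with
      | none => simp at hab
      | some l =>
        have hy : Turing.TM2.stepAux (T.code l) v S = y := by simpa using hab
        refine .step (F := ofMachine T) (l, v) S (hs _ .refl) ?_
        have := ih fun c'' h => hs c'' (.head hab h)
        simpa only [ofMachine, Instr.exec_ofStmt, hy] using this
  exact key _ hc hs

end Frag

end ofMachine

section toMachine

open Turing.TM2 (Stmt Cfg)

variable {K Λ : Type}

def Instr.toStmt : Instr K Λ → Stmt (fun _ : K => Bool) Λ (Option Bool)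
  | .goto x => .goto fun _ => x
  | .push k b I => .push k (fun _ => b) (toStmt I)
  | .pop k f => .pop k (fun _ o => o) (.branch (fun o => o == none) (toStmt (f none))
      (.branch (fun o => o == some true) (toStmt (f (some true))) (toStmt (f (some false)))))

theorem Instr.stepAux_toStmt [DecidableEq K] (I : Instr K Λ) (v : Option Bool)
    (S : K → List Bool) :
    ∃ v', Turing.TM2.stepAux (toStmt I) v S = ⟨some (I.exec S).1, v', (I.exec S).2⟩ := by
  induction I generalizing v S with
  | goto x => exact ⟨v, rfl⟩
  | push k b I ih => exact ih _ _
  | pop k f ih =>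
    simp only [toStmt, exec, Turing.TM2.stepAux]
    rcases h : (S k).head? with _ | _ | _ <;> exact ih _ _ _

open Classical in
/-- A machine for a fragment, with the stacks `inp` as input stacks. -/
noncomputable def Frag.toMachine [Fintype K] [DecidableEq K] {a : ℕ} (F : Frag K Unit)
    (inp : Fin a → K) (out : K) : Machine a where
  W := K
  Λ := F.Q ⊕ Unit
  σ := Option Bool
  finΛ := Fintype.ofFinite _
  start := F.start
  init := none
  code := Sum.elim (fun q => ((F.code q).map
    (fun k => if h : ∃ t, inp t = k then Sum.inl h.choose else Sum.inr k) id).toStmt) fun _ => .halt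
  out := if h : ∃ t, inp t = out then Sum.inl h.choose else Sum.inr out

/-- The machine is deterministic, so each reachable configuration lies on the run that `Ends`
describes. `Ends` bounds the cells only before steps, which is why the postcondition must also bound
them at the exit. -/
theorem Frag.computesInSpace_toMachine [Fintype K] [DecidableEq K] {a : ℕ} {F : Frag K Unit}
    {inp : Fin a → K} (hinp : Injective inp) {out : K} {input : Fin a → List Bool}
    {output : List Bool} {s : ℕ}
    (h : F.wp (∑ t, (input t).length + s) (extend inp input fun _ => []) fun _ S =>
      S out = output ∧ cells S ≤ ∑ t, (input t).length + s) :
    (F.toMachine inp out).ComputesInSpace input output s := by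
  classical
  set g : K → Fin a ⊕ K := fun k => if h : ∃ t, inp t = k then Sum.inl h.choose else Sum.inr k
    with hgdef
  have hg₁ : ∀ t, g (inp t) = Sum.inl t := by
    intro t
    have h : ∃ t', inp t' = inp t := ⟨t, rfl⟩
    simp only [hgdef]
    rw [dif_pos h, hinp h.choose_spec]
  have hg₂ : ∀ k, (¬∃ t, inp t = k) → g k = Sum.inr k := fun k hk => by
    simp only [hgdef]; rw [dif_neg hk]
  have hg : Injective g := by
    intro k k' hkk
    by_cases h : ∃ t, inp t = k <;> by_cases h' : ∃ t, inp t = k'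
    · obtain ⟨t, rfl⟩ := h
      obtain ⟨t', rfl⟩ := h'
      rw [hg₁, hg₁] at hkk
      rw [Sum.inl.inj hkk]
    · obtain ⟨t, rfl⟩ := h
      simp [hg₁, hg₂ _ h'] at hkk
    · obtain ⟨t', rfl⟩ := h'
      simp [hg₁, hg₂ _ h] at hkk
    · rw [hg₂ _ h, hg₂ _ h'] at hkk
      exact Sum.inr.inj hkk
  have hS₀ : (Sum.elim input fun _ => [] : Fin a ⊕ K → List Bool) =
      extend g (extend inp input fun _ => []) fun _ => [] := by
    funext x
    by_cases hx : ∃ k, g k = x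
    · obtain ⟨k, rfl⟩ := hx
      rw [hg.extend_apply]
      by_cases h : ∃ t, inp t = k
      · obtain ⟨t, rfl⟩ := h
        rw [hg₁, hinp.extend_apply]; rfl
      · rw [extend_apply' _ _ _ h, hg₂ _ h]; rfl
    · rw [extend_apply' _ _ _ hx]
      cases x with
      | inl t => exact absurd ⟨_, hg₁ t⟩ hx
      | inr k => rfl
  set T := F.toMachine inp out with hT
  have h' := wp_rename hg (S₀ := fun _ => []) h
  rw [← hS₀] at h'
  have hz : cells (fun _ => [] : Fin a ⊕ K → List Bool) = 0 := by simp [cells]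
  rw [hz, Nat.add_zero] at h'
  set B := ∑ t, (input t).length + s
  have hpost : ∀ S' : K → List Bool, S' out = output ∧ cells S' ≤ B →
      extend g S' (fun _ => []) T.out = output ∧ cells (extend g S' fun _ => []) ≤ B := by
    rintro S' ⟨h₁, h₂⟩
    refine ⟨?_, (cells_extend_le hg _ _).trans (by rw [hz]; exact h₂)⟩
    have : T.out = g out := rfl
    rw [this, hg.extend_apply, h₁]
  have key : ∀ x S, (F.rename g).Ends B
      (fun _ S => S T.out = output ∧ cells S ≤ B) x S → ∀ v : Option Bool,
      (∃ c : T.Cfg, Turing.TM2.Reaches T.code ⟨some x, v, S⟩ c ∧ c.l = none ∧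
        c.stk T.out = output) ∧
      ∀ c : T.Cfg, Turing.TM2.Reaches T.code ⟨some x, v, S⟩ c → T.cells c ≤ B := by
    intro x S h
    induction h with
    | done e S h =>
      intro v
      -- An exit is still a label of the machine; one further `halt` step leads to the halted
      -- configuration with the same stacks.
      refine ⟨⟨⟨none, v, S⟩, .single rfl, rfl, h.1⟩, fun c hc => ?_⟩
      rcases Relation.ReflTransGen.cases_head hc with rfl | ⟨c', h₁, h₂⟩
      · exact h.2
      · obtain rfl : (⟨none, v, S⟩ : T.Cfg) = c' := by
          exact Option.some.inj h₁
        rcases Relation.ReflTransGen.cases_head h₂ with rfl | ⟨c', h₃, _⟩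
        · exact h.2
        · exact absurd h₃ (Option.some_ne_none c').symm
    | step q S hc _ ih =>
      intro v
      obtain ⟨v', hv'⟩ := Instr.stepAux_toStmt ((F.rename g).code q) v S
      have hstep : Turing.TM2.step T.code ⟨some (Sum.inl q), v, S⟩ =
          some ⟨some (((F.rename g).code q).exec S).1, v', (((F.rename g).code q).exec S).2⟩ :=
        congrArg some hv'
      obtain ⟨⟨c, h₁, h₂⟩, h₃⟩ := ih v'
      refine ⟨⟨c, .head hstep h₁, h₂⟩, fun c hc' => ?_⟩
      rcases Relation.ReflTransGen.cases_head hc' with rfl | ⟨c', h₄, h₅⟩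
      · exact hc
      · have h₄ : Turing.TM2.step T.code ⟨some (Sum.inl q), v, S⟩ = some c' := h₄
        rw [hstep] at h₄
        obtain rfl := Option.some.inj h₄
        exact h₃ c h₅
  refine key _ _ (h'.mono ?_) none
  rintro e S ⟨S', h₁, rfl⟩
  exact hpost S' h₁

end toMachine

/-! ### Elementary fragments -/

theorem update_update_comm_of_ne {K : Type} [DecidableEq K] {a b : K} (h : a ≠ b)
    (S : K → List Bool) (v w : List Bool) :
    update (update S a v) b w = update (update S b w) a v :=
  update_comm h.symm w v S |>.symm

/-- The digits, least significant first, of the successor; an overflow creates a new digit if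
`grow` holds and is dropped otherwise. -/
def incList (grow : Bool) : List Bool → List Bool
  | [] => if grow then [true] else []
  | false :: l => true :: l
  | true :: l => false :: incList grow l

theorem length_incList (grow : Bool) (l : List Bool) : (incList grow l).length ≤ l.length + 1 := by
  induction l with
  | nil => cases grow <;> simp [incList]
  | cons b l ih => cases b <;> simp [incList, ih]

namespace Frag

variable {K E : Type} [DecidableEq K] [Fintype K] {B : ℕ} {S : K → List Bool}

theorem wp_single {I : Instr K (Unit ⊕ E)} {post : E → (K → List Bool) → Prop}
    (hc : cells S ≤ B)
    (h : Sum.elim (fun _ => (single I).wp B (I.exec S).2 post) (fun e => post e (I.exec S).2)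
      (I.exec S).1) : (single I).wp B S post := by
  refine .step (F := single I) () S hc ?_
  change (single I).Ends B post (I.exec S).1 (I.exec S).2
  rcases hI : (I.exec S).1 with _ | e <;> rw [hI] at h
  · exact h
  · exact .done _ _ h

def push (k : K) (b : Bool) : Frag K Unit := single (.push k b (.goto (Sum.inr ())))

theorem wp_push {k : K} {b : Bool} {post : Unit → (K → List Bool) → Prop} (hc : cells S ≤ B)
    (h : post () (update S k (b :: S k))) : (push k b).wp B S post :=
  wp_single hc h

def pop (k : K) : Frag K (Option Bool) := single (.pop k fun o => .goto (Sum.inr o))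

theorem wp_pop {k : K} {post : Option Bool → (K → List Bool) → Prop} (hc : cells S ≤ B)
    (h : post (S k).head? (update S k (S k).tail)) : (pop k).wp B S post :=
  wp_single hc h

def clear (k : K) : Frag K Unit :=
  single (.pop k fun o => o.elim (.goto (Sum.inr ())) fun _ => .goto (Sum.inl ()))

theorem wp_clear {k : K} {post : Unit → (K → List Bool) → Prop} (hc : cells S ≤ B)
    (h : post () (update S k [])) : (clear k).wp B S post := by
  generalize hl : S k = l
  induction l generalizing S with
  | nil =>
    refine wp_single hc ?_
    simpa [Instr.exec, hl] using h
  | cons b l ih =>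
    refine wp_single hc ?_
    simp only [Instr.exec, hl, List.head?_cons, Option.elim_some, Sum.elim_inl, List.tail_cons]
    refine ih ?_ ?_ ?_
    · have := cells_update S k l
      simp only [hl, List.length_cons] at this
      omega
    · simpa using h
    · simp

def move (a b : K) : Frag K Unit :=
  single (.pop a fun o => o.elim (.goto (Sum.inr ())) fun x => .push b x (.goto (Sum.inl ())))

theorem wp_move {a b : K} (hab : a ≠ b) {post : Unit → (K → List Bool) → Prop}
    (hc : cells S ≤ B) (h : post () (update (update S a []) b ((S a).reverse ++ S b))) :
    (move a b).wp B S post := by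
  generalize hl : S a = l
  induction l generalizing S with
  | nil =>
    refine wp_single hc ?_
    have : update (update S a []) b (S b) = update S a [] := by
      rw [← update_of_ne hab.symm [] S, update_eq_self]
    simpa [Instr.exec, hl, this] using h
  | cons x l ih =>
    refine wp_single hc ?_
    simp only [Instr.exec, hl, List.head?_cons, Option.elim_some, Sum.elim_inl, List.tail_cons]
    refine ih ?_ ?_ ?_
    · have h₁ := cells_update S a l
      have h₂ := cells_update (update S a l) b (x :: update S a l b)
      simp only [hl, List.length_cons] at h₁ h₂
      omega
    · rw [update_of_ne hab, update_self, update_self, update_of_ne hab.symm,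
        update_update_comm_of_ne hab.symm, update_idem, update_idem]
      simpa [hl] using h
    · rw [update_of_ne hab, update_self]

/-- Move `a` to `b` and push `f x` on `c` for every symbol `x` of `a`. -/
def moveBoth (f : Bool → Bool) (a b c : K) : Frag K Unit :=
  single (.pop a fun o => o.elim (.goto (Sum.inr ())) fun x =>
    .push b x (.push c (f x) (.goto (Sum.inl ()))))

/-- Each round removes one symbol and adds two, so the total growth is the length of `a`. -/
theorem wp_moveBoth {f : Bool → Bool} {a b c : K} (hab : a ≠ b) (hac : a ≠ c) (hbc : b ≠ c)
    {post : Unit → (K → List Bool) → Prop} (hc : cells S + (S a).length ≤ B)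
    (h : post () (update (update (update S a []) b ((S a).reverse ++ S b)) c
      (((S a).map f).reverse ++ S c))) :
    (moveBoth f a b c).wp B S post := by
  generalize hl : S a = l at hc
  induction l generalizing S with
  | nil =>
    refine wp_single (by omega) ?_
    have h₁ : update (update S a []) b (S b) = update S a [] := by
      rw [← update_of_ne hab.symm [] S, update_eq_self]
    have h₂ : update (update S a []) c (S c) = update S a [] := by
      rw [← update_of_ne hac.symm [] S, update_eq_self]
    simpa [Instr.exec, hl, h₁, h₂] using h
  | cons x l ih =>
    simp only [List.length_cons] at hc
    refine wp_single (by omega) ?_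
    simp only [Instr.exec, hl, List.head?_cons, Option.elim_some, Sum.elim_inl, List.tail_cons]
    refine ih ?_ ?_ ?_
    · convert h using 1
      funext k
      by_cases hkc : k = c
      · subst hkc
        simp [hl, hab, hac, hbc, hac.symm, hbc.symm]
      · by_cases hkb : k = b
        · subst hkb
          simp [hl, hab, hac, hbc, hab.symm]
        · by_cases hka : k = a
          · subst hka; simp [hab, hac]
          · simp [hkc, hkb, hka]
    · rw [update_of_ne hac, update_of_ne hab, update_self]
    · have h₁ := cells_update S a l
      have h₂ := cells_update (update S a l) b (x :: update S a l b)
      have h₃ := cells_update (update (update S a l) b (x :: update S a l b)) c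
        (f x :: update (update S a l) b (x :: update S a l b) c)
      simp only [hl, List.length_cons] at h₁ h₂ h₃
      omega

/-- Put the symbols of `a`, changed by `f`, on top of `b`. -/
def copyMap (f : Bool → Bool) (a b tmp : K) : Frag K Unit :=
  (move a tmp).bind fun _ => moveBoth f tmp a b

/-- Moving to `tmp` and back reverses twice, which restores the order. -/
theorem wp_copyMap {f : Bool → Bool} {a b tmp : K} (hab : a ≠ b) (hat : a ≠ tmp) (hbt : b ≠ tmp)
    {post : Unit → (K → List Bool) → Prop} (ht : S tmp = []) (hc : cells S + (S a).length ≤ B)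
    (h : post () (update S b ((S a).map f ++ S b))) :
    (copyMap f a b tmp).wp B S post := by
  refine wp_bind (wp_move hat (by omega) (wp_moveBoth hat.symm hbt.symm hab ?_ ?_))
  · have h₁ := cells_update S a []
    have h₂ := cells_update (update S a []) tmp ((S a).reverse ++ S tmp)
    simp only [update_of_ne hat.symm, update_self, List.length_append, List.length_reverse, ht,
      List.length_nil] at h₁ h₂ ⊢
    omega
  · convert h using 1
    funext k
    by_cases hkb : k = b
    · subst hkb
      simp [ht, hab.symm, hbt]
    · by_cases hka : k = a
      · subst hka; simp [ht, hab, hat]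
      · by_cases hkt : k = tmp
        · subst hkt; simp [hbt.symm, hat.symm, ht]
        · simp [hkb, hka, hkt]

def incCarry (grow : Bool) (a tmp : K) : Frag K Bool :=
  single (.pop a fun o => match o with
    | none => if grow then .push a true (.goto (Sum.inr true)) else .goto (Sum.inr true)
    | some false => .push a true (.goto (Sum.inr false))
    | some true => .push tmp false (.goto (Sum.inl ())))

/-- The digits passed by the carry lie reversed on `tmp`, so the result is the concatenation
`w.reverse ++ v`. The carry runs off the end exactly when all digits are ones. -/
theorem wp_incCarry {grow : Bool} {a tmp : K} (hat : a ≠ tmp)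
    {post : Bool → (K → List Bool) → Prop} (hc : cells S ≤ B)
    (h : ∀ v w, w.reverse ++ v = (S tmp).reverse ++ incList grow (S a) →
      post ((S a).all id) (update (update S a v) tmp w)) :
    (incCarry grow a tmp).wp B S post := by
  generalize hl : S a = l at h
  induction l generalizing S with
  | nil =>
    refine wp_single (by omega) ?_
    cases grow
    · have := h [] (S tmp) rfl
      rw [← update_of_ne hat.symm [] S, update_eq_self] at this
      simpa [Instr.exec, hl] using this
    · have := h [true] (S tmp) rfl
      rw [← update_of_ne hat.symm [true] S, update_eq_self] at this
      simpa [Instr.exec, hl] using this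
  | cons x l ih =>
    refine wp_single (by omega) ?_
    cases x with
    | false =>
      have := h (true :: l) (S tmp) rfl
      rw [← update_of_ne hat.symm (true :: l) S, update_eq_self] at this
      simpa [Instr.exec, hl] using this
    | true =>
      simp only [Instr.exec, hl, List.head?_cons, Sum.elim_inl, List.tail_cons]
      refine ih ?_ ?_ ?_
      · have h₁ := cells_update S a l
        have h₂ := cells_update (update S a l) tmp (false :: update S a l tmp)
        simp only [hl, List.length_cons] at h₁ h₂
        omega
      · rw [update_of_ne hat, update_self]
      · intro v w hvw
        have := h v w (by simpa [incList, hat.symm] using hvw)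
        rw [update_update_comm_of_ne hat.symm, update_idem, update_idem]
        simpa using this

/-- Replace `a` by `incList grow a`; the exit tells whether there was an overflow. -/
def inc (grow : Bool) (a tmp : K) : Frag K Bool :=
  (incCarry grow a tmp).bind fun o => (move tmp a).bind fun _ => Frag.pure o

theorem wp_inc {grow : Bool} {a tmp : K} (hat : a ≠ tmp) {post : Bool → (K → List Bool) → Prop}
    (ht : S tmp = []) (hc : cells S + 1 ≤ B)
    (h : post ((S a).all id) (update S a (incList grow (S a)))) : (inc grow a tmp).wp B S post := by
  refine wp_bind (wp_incCarry hat (by omega) fun v w hvw => ?_)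
  rw [ht, List.reverse_nil, List.nil_append] at hvw
  refine wp_bind (wp_move hat.symm ?_ (wp_pure ?_))
  · have h₁ := cells_update S a v
    have h₂ := cells_update (update S a v) tmp w
    have h₃ := length_incList grow (S a)
    have h₄ := congrArg List.length hvw
    simp only [List.length_append, List.length_reverse] at h₄
    rw [update_of_ne hat.symm, ht, List.length_nil] at h₂
    omega
  · convert h using 1
    funext k
    by_cases hka : k = a
    · subst hka; simp [hat, hvw]
    · by_cases hkt : k = tmp
      · subst hkt; simp [hat.symm, ht]
      · simp [hka, hkt]

/-- Compare the stacks `a` and `b`, destroying them. -/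
def eqPop (a b : K) : Frag K Bool :=
  single (.pop a fun o => .pop b fun o' =>
    if o = o' then (if o = none then .goto (Sum.inr true) else .goto (Sum.inl ()))
    else .goto (Sum.inr false))

/-- The comparison stops at the first difference. The remainders are left unspecified apart from
their total length; `eqTest` works on copies and clears them. -/
theorem wp_eqPop {a b : K} (hab : a ≠ b) {post : Bool → (K → List Bool) → Prop}
    (hc : cells S ≤ B)
    (h : ∀ v w, v.length + w.length ≤ (S a).length + (S b).length →
      post (decide (S a = S b)) (update (update S a v) b w)) :
    (eqPop a b).wp B S post := by
  generalize hl : S a = l at h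
  induction l generalizing S with
  | nil =>
    refine wp_single (by omega) ?_
    cases hb : S b with
    | nil =>
      have := h [] [] (by simp)
      simpa [Instr.exec, hl, hb, hab.symm] using this
    | cons y l' =>
      have := h [] l' (by simp [hb])
      simpa [Instr.exec, hl, hb, hab.symm] using this
  | cons x l ih =>
    refine wp_single (by omega) ?_
    cases hb : S b with
    | nil =>
      have := h l [] (by simp; omega)
      simpa [Instr.exec, hl, hb, hab.symm] using this
    | cons y l' =>
      by_cases hxy : x = y
      · subst hxy
        simp only [Instr.exec, hl, hb, update_of_ne hab.symm, List.head?_cons, List.tail_cons,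
          if_true, reduceCtorEq, if_false, Sum.elim_inl]
        refine ih ?_ ?_ ?_
        · have h₁ := cells_update S a l
          have h₂ := cells_update (update S a l) b l'
          simp only [hl, hb, update_of_ne hab.symm, List.length_cons] at h₁ h₂
          omega
        · rw [update_of_ne hab, update_self]
        · intro v w hvw
          have := h v w (by simp [hb] at hvw ⊢; omega)
          rw [update_update_comm_of_ne hab.symm, update_idem, update_idem]
          simpa [hb] using this
      · have := h l l' (by simp [hb]; omega)
        simpa [Instr.exec, hl, hb, hab.symm, hxy] using this

/-- Compare the stacks `a` and `b`. -/
def eqTest (a b t₁ t₂ tmp : K) : Frag K Bool :=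
  (copyMap id a t₁ tmp).bind fun _ => (copyMap id b t₂ tmp).bind fun _ =>
    (eqPop t₁ t₂).bind fun o => (clear t₁).bind fun _ => (clear t₂).bind fun _ => Frag.pure o

theorem wp_eqTest {a b t₁ t₂ tmp : K} (ha : a ∉ [t₁, t₂, tmp]) (hb : b ∉ [t₁, t₂, tmp])
    (ht : [t₁, t₂, tmp].Nodup) {post : Bool → (K → List Bool) → Prop}
    (h₁ : S t₁ = []) (h₂ : S t₂ = []) (h₃ : S tmp = [])
    (hc : cells S + (S a).length + (S b).length ≤ B)
    (h : post (decide (S a = S b)) S) : (eqTest a b t₁ t₂ tmp).wp B S post := by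
  simp only [List.mem_cons, List.not_mem_nil, or_false, not_or, List.nodup_cons, not_false_eq_true,
    List.nodup_nil, and_true] at ha hb ht
  obtain ⟨ha₁, ha₂, ha₃⟩ := ha
  obtain ⟨hb₁, hb₂, hb₃⟩ := hb
  obtain ⟨⟨h12, h13⟩, h23⟩ := ht
  have c₁ := cells_update S t₁ (S a)
  have c₂ := cells_update (update S t₁ (S a)) t₂ (S b)
  simp only [update_of_ne (Ne.symm h12), h₁, h₂, List.length_nil] at c₁ c₂
  refine wp_bind (wp_copyMap ha₁ ha₃ h13 h₃ (by omega) ?_)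
  simp only [List.map_id, h₁, List.append_nil]
  refine wp_bind (wp_copyMap hb₂ hb₃ h23 ?_ ?_ ?_)
  · rw [update_of_ne (Ne.symm h13), h₃]
  · rw [update_of_ne hb₁]; omega
  simp only [List.map_id, update_of_ne hb₁, update_of_ne (Ne.symm h12), h₂, List.append_nil]
  refine wp_bind (wp_eqPop h12 (by omega) fun v w hvw => ?_)
  simp only [update_of_ne h12, update_self] at hvw ⊢
  rw [update_update_comm_of_ne (Ne.symm h12), update_idem, update_idem]
  have d₁ := cells_update S t₁ v
  have d₂ := cells_update (update S t₁ v) t₂ w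
  have d₃ := cells_update (update (update S t₁ v) t₂ w) t₁ []
  simp only [update_of_ne (Ne.symm h12), h₁, h₂, List.length_nil] at d₁ d₂ d₃
  refine wp_bind (wp_clear (by omega) (wp_bind (wp_clear (by omega) (wp_pure ?_))))
  convert h using 1
  funext k
  by_cases hk1 : k = t₁
  · subst hk1; simp [h12, h₁]
  · by_cases hk2 : k = t₂
    · subst hk2; simp [h₂]
    · simp [hk1, hk2]

def forAll {ι : Type} (l : List ι) (F : ι → Frag K Unit) : Frag K Unit :=
  l.foldr (fun a G => (F a).bind fun _ => G) (Frag.pure ())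

theorem wp_forAll_clear {l : List K} {post : Unit → (K → List Bool) → Prop}
    (hc : cells S ≤ B)
    (h : ∀ S', (∀ k ∈ l, S' k = []) → (∀ k ∉ l, S' k = S k) → post () S') :
    (forAll l clear).wp B S post := by
  induction l generalizing S with
  | nil => exact wp_pure (h S (by simp) (by simp))
  | cons a l ih =>
    refine wp_bind (wp_clear hc (ih ?_ fun S' h₁ h₂ => h S' ?_ ?_))
    · have := cells_update S a []
      simp only [List.length_nil] at this
      omega
    · intro k hk
      by_cases hkl : k ∈ l
      · exact h₁ k hkl
      · obtain rfl : k = a := by simpa [hkl] using hk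
        rw [h₂ k hkl, update_self]
    · intro k hk
      simp only [List.mem_cons, not_or] at hk
      rw [h₂ k hk.2, update_of_ne hk.1]

theorem wp_forAll_copy {ι : Type} {l : List ι} (hl : l.Nodup) {src dst : ι → K} {tmp : K}
    (hd : Injective dst) (hsd : ∀ t t', src t ≠ dst t') (hs : ∀ t, src t ≠ tmp)
    (hdt : ∀ t, dst t ≠ tmp) (htmp : S tmp = []) (he : ∀ t ∈ l, S (dst t) = [])
    {post : Unit → (K → List Bool) → Prop}
    (hc : cells S + (l.map fun t => (S (src t)).length).sum ≤ B)
    (h : ∀ S', (∀ t ∈ l, S' (dst t) = S (src t)) → (∀ k, (∀ t ∈ l, k ≠ dst t) → S' k = S k) →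
      cells S' ≤ B → post () S') :
    (forAll l fun t => copyMap id (src t) (dst t) tmp).wp B S post := by
  induction l generalizing S with
  | nil => exact wp_pure (h S (by simp) (by simp) (by simpa using hc))
  | cons a l ih =>
    rw [List.nodup_cons] at hl
    simp only [List.map_cons, List.sum_cons] at hc
    have h₀ : S (dst a) = [] := he a (by simp)
    refine wp_bind (wp_copyMap (hsd a a) (hs a) (hdt a) htmp (by omega) ?_)
    rw [List.map_id, h₀, List.append_nil]
    have hsrc : ∀ t, update S (dst a) (S (src a)) (src t) = S (src t) :=
      fun t => update_of_ne (hsd t a) _ _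
    refine ih hl.2 ?_ ?_ ?_ ?_
    · rw [update_of_ne (hdt a).symm, htmp]
    · intro t ht
      rw [update_of_ne, he t (by simp [ht])]
      intro hta
      exact hl.1 (hd hta ▸ ht)
    · have := cells_update S (dst a) (S (src a))
      simp only [hsrc, h₀, List.length_nil] at this ⊢
      omega
    · intro S' h₁ h₂ h₃
      refine h S' ?_ ?_ h₃
      · intro t ht
        by_cases htl : t ∈ l
        · rw [h₁ t htl, hsrc]
        · obtain rfl : t = a := by simpa [htl] using ht
          rw [h₂, update_self]
          intro t' ht' htt
          exact htl (hd htt ▸ ht')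
      · intro k hk
        rw [h₂ k fun t ht => hk t (by simp [ht]), update_of_ne (hk a (by simp))]

/-- Run the machine `M` on the contents of the stacks `args` and put the output on `res`; the stacks
of `M` are given by `g`. -/
noncomputable def call {n : ℕ} (M : Machine n) (g : Fin n ⊕ M.W → K) (args : Fin n → K)
    (res tmp : K) : Frag K Unit :=
  (forAll (Finset.univ : Finset (Fin n)).toList fun t =>
      copyMap id (args t) (g (Sum.inl t)) tmp).bind fun _ =>
    ((ofMachine M).rename g).bind fun _ => (move (g M.out) tmp).bind fun _ =>
      (move tmp res).bind fun _ =>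
        forAll ((Finset.univ : Finset (Fin n ⊕ M.W)).toList.map g) clear

/-- A call costs a copy of the arguments and the space `s` of the machine. Afterwards all stacks of
the machine are empty again, so later calls reuse them. -/
theorem wp_call {n : ℕ} {M : Machine n} {g : Fin n ⊕ M.W → K} (hg : Injective g)
    {args : Fin n → K} {res tmp : K} (hga : ∀ x t, args t ≠ g x) (hgr : ∀ x, res ≠ g x)
    (hgt : ∀ x, tmp ≠ g x) (hat : ∀ t, args t ≠ tmp) (hrt : res ≠ tmp)
    {post : Unit → (K → List Bool) → Prop} {s : ℕ} {output : List Bool}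
    (hM : M.ComputesInSpace (fun t => S (args t)) output s)
    (hS : ∀ x, S (g x) = []) (hr : S res = []) (ht : S tmp = [])
    (hc : cells S + ∑ t, (S (args t)).length + s ≤ B)
    (h : post () (update S res output)) : (call M g args res tmp).wp B S post := by
  refine wp_bind (wp_forAll_copy (Finset.nodup_toList _) (dst := fun t => g (Sum.inl t))
    (hg.comp Sum.inl_injective) (fun t t' => hga _ _) hat (fun t => (hgt _).symm) ht
    (fun t _ => hS _) ?_ fun S₁ h₁ h₂ h₃ => ?_)
  · rw [Finset.sum_map_toList]; omega
  -- After the copying, the stacks of `M` hold precisely its initial configuration on these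
  -- arguments.
  have hS₁ : S₁ = extend g (Sum.elim (fun t => S (args t)) fun _ => []) S := by
    funext k
    by_cases hk : ∃ x, g x = k
    · obtain ⟨x, rfl⟩ := hk
      rw [hg.extend_apply]
      cases x with
      | inl t => exact h₁ t (by simp)
      | inr w => rw [h₂ _ fun t _ => by simpa using hg.ne (by simp), hS]; rfl
    · rw [extend_apply' _ _ _ hk, h₂]
      rintro t - rfl
      exact hk ⟨_, rfl⟩
  rw [hS₁]
  refine wp_bind (((wp_rename hg (wp_ofMachine hM)).mono_bound (by omega)).mono ?_)
  rintro - - ⟨S', ⟨ho, hc'⟩, rfl⟩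
  set S₂ := extend g S' S with hS₂
  have hcS₂ : cells S₂ ≤ B := (cells_extend_le hg _ _).trans (by omega)
  have hS₂g : ∀ x, S₂ (g x) = S' x := fun x => hg.extend_apply _ _ _
  have hS₂n : ∀ k, (∀ x, k ≠ g x) → S₂ k = S k := fun k hk =>
    extend_apply' _ _ _ fun ⟨x, hx⟩ => hk x hx.symm
  -- The output passes through `tmp` and is reversed twice.
  refine wp_bind (wp_move (hgt _).symm hcS₂ (wp_bind (wp_move hrt.symm ?_ (wp_forAll_clear ?_
    fun S₃ h₃ h₄ => ?_))))
  · have d₁ := cells_update S₂ (g M.out) []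
    have d₂ := cells_update (update S₂ (g M.out) []) tmp ((S₂ (g M.out)).reverse ++ S₂ tmp)
    simp only [update_of_ne (hgt _), List.length_append, List.length_reverse,
      List.length_nil] at d₁ d₂
    omega
  · have d₁ := cells_update S₂ (g M.out) []
    have d₂ := cells_update (update S₂ (g M.out) []) tmp ((S₂ (g M.out)).reverse ++ S₂ tmp)
    set S₄ := update (update S₂ (g M.out) []) tmp ((S₂ (g M.out)).reverse ++ S₂ tmp)
    have d₃ := cells_update S₄ tmp []
    have d₄ := cells_update (update S₄ tmp []) res ((S₄ tmp).reverse ++ S₄ res)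
    simp only [update_of_ne (hgt _), update_of_ne hrt, List.length_append, List.length_reverse,
      List.length_nil] at d₁ d₂ d₃ d₄
    omega
  · convert h using 1
    funext k
    by_cases hk : ∃ x, g x = k
    · obtain ⟨x, rfl⟩ := hk
      rw [h₃ _ (by simp), update_of_ne (hgr x).symm, hS]
    · have hk' : ∀ x, k ≠ g x := fun x hx => hk ⟨x, hx.symm⟩
      rw [h₄ k (by simpa using hk)]
      by_cases hkr : k = res
      · subst hkr
        simp [hrt, hgt, hgr, hS₂g, hS₂n, ho, hr, ht]
      · by_cases hkt : k = tmp
        · subst hkt; simp [hkr, ht]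
        · simp [hkr, hkt, hk', hS₂n]

end Frag

/-! ### Binary numbers and strings -/

theorem incList_bits (n : ℕ) : incList true n.bits = (n + 1).bits := by
  induction n using Nat.binaryRec' with
  | zero => simp [incList]
  | bit b n h ih =>
    rw [Nat.bits_append_bit _ _ h]
    cases b with
    | false =>
      have : Nat.bit false n + 1 = 2 * n + 1 := by simp [Nat.bit]
      rw [this, Nat.bit1_bits]; rfl
    | true =>
      have : Nat.bit true n + 1 = 2 * (n + 1) := by simp [Nat.bit]; omega
      rw [this, Nat.bit0_bits _ (by omega), ← ih]; rfl

/-- Digits are listed from the least significant one, so leading zeros of the list multiply by a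
power of two. Zero is excluded because its digit list is empty. -/
theorem replicate_append_bits (k u : ℕ) (hu : u ≠ 0) :
    List.replicate k false ++ u.bits = (u * 2 ^ k).bits := by
  induction k with
  | zero => simp
  | succ k ih =>
    have : u * 2 ^ (k + 1) = 2 * (u * 2 ^ k) := by ring
    rw [this, Nat.bit0_bits _ (by positivity), ← ih]; rfl

theorem bits_injective : Injective Nat.bits := by
  intro n m h
  induction n using Nat.binaryRec' generalizing m with
  | zero =>
    have := congrArg List.length h
    rw [Nat.size_eq_bits_len, Nat.size_eq_bits_len, Nat.size_zero] at this
    exact (Nat.size_eq_zero.1 this.symm).symm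
  | bit b n hb ih =>
    rw [Nat.bits_append_bit _ _ hb] at h
    induction m using Nat.binaryRec' with
    | zero => simp at h
    | bit b' m hb' _ =>
      rw [Nat.bits_append_bit _ _ hb'] at h
      obtain ⟨rfl, h'⟩ := List.cons.inj h
      rw [ih h']

theorem length_bits_le {n k : ℕ} : n.bits.length ≤ k ↔ n < 2 ^ k := by
  rw [Nat.size_eq_bits_len, Nat.size_le]

/-- The string of the `d` low-order binary digits of `v`. -/
def strOf (d v : ℕ) : Str d := fun i => v.testBit i

def binStr (d v : ℕ) : List Bool := List.ofFn (strOf d v)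

theorem length_binStr (d v : ℕ) : (binStr d v).length = d := by simp [binStr]

theorem binStr_succ (d v : ℕ) : binStr (d + 1) v = v.testBit 0 :: binStr d (v / 2) := by
  simp [binStr, List.ofFn_succ, Nat.testBit_succ, strOf, funext_iff]

theorem binStr_mul_two_pow (d c : ℕ) : binStr d (c * 2 ^ d) = List.replicate d false := by
  induction d with
  | zero => rfl
  | succ d ih =>
    have : c * 2 ^ (d + 1) = 2 * (c * 2 ^ d) := by ring
    rw [binStr_succ, this, Nat.mul_div_cancel_left _ (by norm_num), ih, List.replicate_succ]
    simp

theorem incList_binStr (d v : ℕ) : incList false (binStr d v) = binStr d (v + 1) := by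
  induction d generalizing v with
  | zero => rfl
  | succ d ih =>
    rw [binStr_succ, binStr_succ]
    rcases Nat.even_or_odd' v with ⟨w, rfl | rfl⟩
    · have h₁ : (2 * w + 1) / 2 = w := by omega
      have h₂ : (2 * w) / 2 = w := by omega
      simp [h₁, h₂, incList]
    · have h₁ : (2 * w + 1) / 2 = w := by omega
      have h₂ : (2 * w + 1 + 1) / 2 = w + 1 := by omega
      simp [h₁, h₂, incList, ih]
      omega

theorem all_binStr (d v : ℕ) (hv : v < 2 ^ d) :
    (binStr d v).all id = decide (v + 1 = 2 ^ d) := by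
  induction d generalizing v with
  | zero => simp [binStr]; omega
  | succ d ih =>
    rw [binStr_succ, List.all_cons, ih _ (by omega)]
    rcases Nat.even_or_odd' v with ⟨w, rfl | rfl⟩
    · simp; omega
    · have h₁ : (2 * w + 1) / 2 = w := by omega
      rw [h₁, Nat.pow_succ']
      simp; omega

/-- A counter running through all values below $2^d$ visits every string once; this turns loops into
counts and quantifiers over edges. -/
theorem strOf_bijOn (d : ℕ) :
    Set.BijOn (strOf d) (Finset.range (2 ^ d) : Set ℕ) (Finset.univ : Finset (Str d)) := by
  classical
  have hinj : Set.InjOn (strOf d) (Finset.range (2 ^ d) : Set ℕ) := by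
    intro v hv w hw h
    simp only [Finset.coe_range, Set.mem_Iio] at hv hw
    refine Nat.eq_of_testBit_eq fun i => ?_
    by_cases hi : i < d
    · exact congrFun h ⟨i, hi⟩
    · have : 2 ^ d ≤ 2 ^ i := Nat.pow_le_pow_right (by norm_num) (by omega)
      rw [Nat.testBit_lt_two_pow (hv.trans_le this), Nat.testBit_lt_two_pow (hw.trans_le this)]
  refine ⟨fun _ _ => by simp, hinj, ?_⟩
  have : (Finset.range (2 ^ d)).image (strOf d) = Finset.univ := by
    refine Finset.eq_univ_of_card _ ?_
    rw [Finset.card_image_of_injOn hinj]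
    simp
  intro s hs
  have hs : s ∈ (Finset.range (2 ^ d)).image (strOf d) := this ▸ Finset.mem_univ s
  simpa using hs

theorem card_filter_strOf (d : ℕ) (P : Str d → Prop) [DecidablePred P] :
    ((Finset.range (2 ^ d)).filter fun v => P (strOf d v)).card =
      (Finset.univ.filter P).card := by
  have h := strOf_bijOn d
  refine Finset.card_bij (fun v _ => strOf d v) ?_ ?_ ?_
  · intro v hv; simpa using (Finset.mem_filter.1 hv).2
  · intro v hv w hw
    exact h.injOn (Finset.mem_coe.2 (Finset.mem_filter.1 hv).1)
      (Finset.mem_coe.2 (Finset.mem_filter.1 hw).1)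
  · intro s hs
    obtain ⟨v, hv, rfl⟩ := h.surjOn (Finset.mem_coe.2 (Finset.mem_univ s))
    exact ⟨v, Finset.mem_filter.2 ⟨hv, (Finset.mem_filter.1 hs).2⟩, rfl⟩

theorem forall_strOf (d : ℕ) (P : Str d → Prop) :
    (∀ v < 2 ^ d, P (strOf d v)) ↔ ∀ s, P s := by
  refine ⟨fun h s => ?_, fun h v _ => h _⟩
  obtain ⟨v, hv, rfl⟩ := (strOf_bijOn d).surjOn (Finset.mem_coe.2 (Finset.mem_univ s))
  exact h v (by simpa using hv)

/-! ### Loops -/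

namespace Frag

variable {K : Type} [DecidableEq K] [Fintype K] {B : ℕ}

/-- Run `body` for all strings on `e` that are as long as the stack `d`. -/
def forStr (d e tmp : K) (body : Frag K Unit) : Frag K Unit :=
  (copyMap (fun _ => false) d e tmp).bind fun _ =>
    (loop (body.bind fun _ => (inc false e tmp).bind fun o =>
      Frag.pure (if o then some () else none))).bind fun _ => clear e

/-- `X v` is the memory after `v` rounds, apart from the counter on `e`. The hypothesis on `body` is
quantified over `post`, so it can be chained with the rest of the loop. -/
theorem wp_forStr {d e tmp : K} {body : Frag K Unit} (hde : d ≠ e) (hdt : d ≠ tmp) (het : e ≠ tmp)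
    {X : ℕ → K → List Bool} {D : ℕ} (hd : (X 0 d).length = D)
    (he : ∀ v ≤ 2 ^ D, X v e = []) (ht : ∀ v ≤ 2 ^ D, X v tmp = [])
    (hc : ∀ v ≤ 2 ^ D, cells (X v) + D + 1 ≤ B)
    (hbody : ∀ v < 2 ^ D, ∀ post : Unit → (K → List Bool) → Prop,
      post () (update (X (v + 1)) e (binStr D v)) → body.wp B (update (X v) e (binStr D v)) post)
    {post : Unit → (K → List Bool) → Prop} (h : post () (X (2 ^ D))) :
    (forStr d e tmp body).wp B (X 0) post := by
  have hcu : ∀ v ≤ 2 ^ D, ∀ w, cells (update (X v) e (binStr D w)) + 1 ≤ B := by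
    intro v hv w
    have h₁ := cells_update (X v) e (binStr D w)
    have h₂ := hc v hv
    rw [length_binStr, he v hv, List.length_nil] at h₁
    omega
  refine wp_bind (wp_copyMap hde hdt het (ht 0 (by simp)) (by have := hc 0 (by simp); omega) ?_)
  have h0 : (X 0 d).map (fun _ => false) ++ X 0 e = binStr D 0 := by
    rw [he 0 (by simp), List.map_const', List.append_nil, hd]
    simpa using (binStr_mul_two_pow D 0).symm
  rw [h0]
  refine wp_bind ?_
  -- Induction on the number `m` of rounds after the current one. The last round has the string of
  -- ones on `e`; its overflow ends the loop.
  have key : ∀ m v, v + m + 1 = 2 ^ D → (loop (body.bind fun _ => (inc false e tmp).bind fun o =>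
      Frag.pure (if o then some () else none))).wp B (update (X v) e (binStr D v))
      fun _ S' => (clear e).wp B S' post := by
    intro m
    induction m with
    | zero =>
      intro v hv
      refine wp_loop (by have := hcu v (by omega) v; omega)
        (wp_bind (hbody v (by omega) _ (wp_bind (wp_inc het ?_ ?_ ?_))))
      · rw [update_of_ne het.symm, ht _ (by omega)]
      · exact hcu _ (by omega) _
      · rw [update_self, all_binStr _ _ (by omega), decide_eq_true (by omega), update_idem]
        refine wp_pure ?_
        simp only [if_true, Option.elim_some]
        rw [incList_binStr]
        refine wp_clear (by have := hcu (v + 1) (by omega) (v + 1); omega) ?_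
        rw [update_idem, ← he (v + 1) (by omega), update_eq_self]
        have : v + 1 = 2 ^ D := by omega
        rwa [this]
    | succ m ih =>
      intro v hv
      refine wp_loop (by have := hcu v (by omega) v; omega)
        (wp_bind (hbody v (by omega) _ (wp_bind (wp_inc het ?_ ?_ ?_))))
      · rw [update_of_ne het.symm, ht _ (by omega)]
      · exact hcu _ (by omega) _
      · rw [update_self, all_binStr _ _ (by omega), decide_eq_false (by omega), update_idem]
        refine wp_pure ?_
        simp only [Bool.false_eq_true, if_false, Option.elim_none]
        rw [incList_binStr]
        exact ih (v + 1) (by omega)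
  have hpos : 0 < 2 ^ D := by positivity
  exact key (2 ^ D - 1) 0 (by omega)

/-- Run `body` with the successive answers of `fetch` on `ans`, until an answer is empty; the index
of the answer is on `idx`. -/
def forList (fetch : Frag K Unit) (idx ans tmp : K) (body : Frag K Unit) : Frag K Unit :=
  (loop (fetch.bind fun _ => (pop ans).bind fun o => o.elim (Frag.pure (some ())) fun _ =>
    body.bind fun _ => (clear ans).bind fun _ => (inc true idx tmp).bind fun _ =>
      Frag.pure none)).bind fun _ => clear idx

/-- The hypothesis on `fetch` includes `v = N`, where the empty answer ends the loop. The leading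
bit of a nonempty answer is popped, so `body` sees the bare string `A v`. -/
theorem wp_forList {fetch body : Frag K Unit} {idx ans tmp : K} (hia : idx ≠ ans) (hit : idx ≠ tmp)
    {X : ℕ → K → List Bool} {N ℓ : ℕ} {A : ℕ → List Bool}
    (hi : ∀ v ≤ N, X v idx = []) (ha : ∀ v ≤ N, X v ans = []) (ht : ∀ v ≤ N, X v tmp = [])
    (hb : ∀ v ≤ N, (Nat.bits v).length ≤ ℓ) (hA : ∀ v < N, (A v).length ≤ ℓ)
    (hc : ∀ v ≤ N, cells (X v) + 2 * ℓ + 1 ≤ B)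
    (hfetch : ∀ v ≤ N, ∀ post : Unit → (K → List Bool) → Prop,
      post () (update (update (X v) idx v.bits) ans (if v < N then true :: A v else [])) →
      fetch.wp B (update (X v) idx v.bits) post)
    (hbody : ∀ v < N, ∀ post : Unit → (K → List Bool) → Prop,
      post () (update (update (X (v + 1)) idx v.bits) ans (A v)) →
      body.wp B (update (update (X v) idx v.bits) ans (A v)) post)
    {post : Unit → (K → List Bool) → Prop} (h : post () (X N)) :
    (forList fetch idx ans tmp body).wp B (X 0) post := by
  have hcu : ∀ v ≤ N, ∀ w ≤ N, ∀ l : List Bool,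
      cells (update (update (X v) idx w.bits) ans l) + ℓ + 1 ≤ B + l.length := by
    intro v hv w hw l
    have h₁ := cells_update (X v) idx w.bits
    have h₂ := cells_update (update (X v) idx w.bits) ans l
    have h₃ := hc v hv
    have h₄ := hb w hw
    rw [update_of_ne hia.symm, ha v hv, List.length_nil] at h₂
    rw [hi v hv, List.length_nil] at h₁
    omega
  have hcv : ∀ v ≤ N, ∀ w ≤ N, cells (update (X v) idx w.bits) + ℓ + 1 ≤ B := by
    intro v hv w hw
    have h₁ := cells_update (X v) idx w.bits
    have h₃ := hc v hv
    have h₄ := hb w hw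
    rw [hi v hv, List.length_nil] at h₁
    omega
  refine wp_bind ?_
  have h0 : X 0 = update (X 0) idx (Nat.bits 0) := by
    rw [Nat.zero_bits, ← hi 0 (by simp), update_eq_self]
  rw [h0]
  have key : ∀ m v, v + m = N → (loop (fetch.bind fun _ => (pop ans).bind fun o =>
      o.elim (Frag.pure (some ())) fun _ => body.bind fun _ => (clear ans).bind fun _ =>
        (inc true idx tmp).bind fun _ => Frag.pure none)).wp B (update (X v) idx v.bits)
      fun _ S' => (clear idx).wp B S' post := by
    intro m
    induction m with
    | zero =>
      intro v hv
      obtain rfl : v = N := by omega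
      refine wp_loop (by have := hcv v le_rfl v le_rfl; omega)
        (wp_bind (hfetch v le_rfl _ (wp_bind (wp_pop ?_ ?_))))
      · have := hcu v le_rfl v le_rfl []
        simp only [lt_irrefl, if_false, List.length_nil] at this ⊢
        omega
      · simp only [lt_irrefl, if_false, update_self, List.head?_nil, Option.elim_none,
          List.tail_nil, update_idem]
        refine wp_pure ?_
        refine wp_clear (by have := hcu v le_rfl v le_rfl []; simp at this; omega) ?_
        rw [update_update_comm_of_ne hia.symm, update_idem]
        have h₁ : update (X v) idx [] = X v := by rw [← hi v le_rfl, update_eq_self]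
        have h₂ : update (X v) ans [] = X v := by rw [← ha v le_rfl, update_eq_self]
        rwa [h₁, h₂]
    | succ m ih =>
      intro v hv
      have hvN : v < N := by omega
      refine wp_loop (by have := hcv v (by omega) v (by omega); omega)
        (wp_bind (hfetch v (by omega) _ (wp_bind (wp_pop ?_ ?_))))
      · have := hcu v (by omega) v (by omega) (true :: A v)
        have := hA v hvN
        simp only [hvN, if_true, List.length_cons] at *
        omega
      · simp only [hvN, if_true, update_self, List.head?_cons, Option.elim_some,
          List.tail_cons, update_idem]
        refine wp_bind (hbody v hvN _ (wp_bind (wp_clear ?_ ?_)))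
        · have := hcu (v + 1) (by omega) v (by omega) (A v)
          have := hA v hvN
          omega
        rw [update_idem, update_update_comm_of_ne hia]
        have h₂ : update (X (v + 1)) ans [] = X (v + 1) := by
          rw [← ha (v + 1) (by omega), update_eq_self]
        rw [h₂]
        refine wp_bind (wp_inc hit ?_ ?_ ?_)
        · rw [update_of_ne hit.symm, ht _ (by omega)]
        · have := hcv (v + 1) (by omega) v (by omega); omega
        rw [update_self, update_idem, incList_bits]
        exact wp_pure (ih (v + 1) (by omega))
  exact key N 0 (by omega)

end Frag

section

/-! ### The registers of the enumerating program -/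

inductive Reg : Type
  | inp (t : Fin 6) | tmp | t₁ | t₂ | z | e | y | e' | y' | idx | x | idx' | x' | cnt | thr | hit
  | ok | out | num | den | rem
  deriving DecidableEq, Fintype

namespace Reg

def scratch : List Reg := [t₁, t₂, tmp]

end Reg

variable {X : Type}

/-- All registers are short, all other stacks are empty, and the scratch registers are empty. -/
structure Ready (ℓ : ℕ) (S : Reg ⊕ X → List Bool) : Prop where
  short : ∀ r, (S (Sum.inl r)).length ≤ ℓ
  empty : ∀ x, S (Sum.inr x) = []
  scratch : ∀ r ∈ Reg.scratch, S (Sum.inl r) = []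

namespace Ready

variable {ℓ : ℕ} {S : Reg ⊕ X → List Bool}

theorem update [DecidableEq X] (h : Ready ℓ S) {r : Reg} (hr : r ∉ Reg.scratch) {v : List Bool}
    (hv : v.length ≤ ℓ) : Ready ℓ (update S (Sum.inl r) v) where
  short := by
    intro r'
    by_cases hrr : r' = r
    · subst hrr; simpa using hv
    · rw [update_of_ne (by simpa using hrr)]; exact h.short r'
  empty := fun x => by rw [update_of_ne (by simp)]; exact h.empty x
  scratch := by
    intro r' hr'
    rw [update_of_ne]
    · exact h.scratch r' hr'
    · intro hrr
      exact hr (Sum.inl.inj hrr ▸ hr')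

theorem cells_le [Fintype X] (h : Ready ℓ S) : cells S ≤ Fintype.card Reg * ℓ := by
  unfold cells
  rw [Fintype.sum_sum_type]
  simp only [h.empty, List.length_nil, Finset.sum_const_zero, add_zero]
  exact (Finset.sum_le_sum fun r _ => h.short r).trans (by simp)

/-- The slack of ten register lengths covers the six argument copies of a call and the temporary
copies and counters of the elementary fragments. -/
theorem room [Fintype X] (h : Ready ℓ S) {s B : ℕ} (hB : (Fintype.card Reg + 10) * (ℓ + 1) + s ≤ B) :
    cells S + 10 * (ℓ + 1) + s ≤ B := by
  have := h.cells_le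
  nlinarith

end Ready

theorem update_nil {K : Type} [DecidableEq K] {S : K → List Bool} {k : K} (h : S k = []) :
    update S k [] = S := by
  rw [← h, update_eq_self]

namespace Frag

open Reg

section Basic

variable [DecidableEq X] [Fintype X] {ℓ s B : ℕ} {S : Reg ⊕ X → List Bool}

def eqR (a b : Reg) : Frag (Reg ⊕ X) Bool :=
  eqTest (Sum.inl a) (Sum.inl b) (Sum.inl t₁) (Sum.inl t₂) (Sum.inl tmp)

theorem wp_eqR (hB : (Fintype.card Reg + 10) * (ℓ + 1) + s ≤ B) (hS : Ready ℓ S) {a b : Reg}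
    (ha : a ∉ scratch) (hb : b ∉ scratch) {post : Bool → (Reg ⊕ X → List Bool) → Prop}
    (h : post (decide (S (Sum.inl a) = S (Sum.inl b))) S) : (eqR a b).wp B S post := by
  refine wp_eqTest ?_ ?_ (by simp) (hS.scratch _ (by decide)) (hS.scratch _ (by decide))
    (hS.scratch _ (by decide)) ?_ h
  · simpa [scratch] using ha
  · simpa [scratch] using hb
  · have := hS.room hB
    have := hS.short a
    have := hS.short b
    omega

def incR (a : Reg) : Frag (Reg ⊕ X) Unit :=
  (inc true (Sum.inl a) (Sum.inl tmp)).bind fun _ => Frag.pure ()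

theorem wp_incR (hB : (Fintype.card Reg + 10) * (ℓ + 1) + s ≤ B) (hS : Ready ℓ S) {a : Reg}
    (ha : a ∉ scratch) {c : ℕ} (hc : S (Sum.inl a) = c.bits)
    {post : Unit → (Reg ⊕ X → List Bool) → Prop}
    (h : post () (update S (Sum.inl a) (c + 1).bits)) : (incR a).wp B S post := by
  refine wp_bind (wp_inc ?_ (hS.scratch _ (by decide)) ?_ (wp_pure ?_))
  · simp only [scratch, List.mem_cons, not_or] at ha
    simp [ha]
  · have := hS.room hB
    omega
  · rwa [hc, incList_bits]

def copyR (f : Bool → Bool) (a b : Reg) : Frag (Reg ⊕ X) Unit :=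
  copyMap f (Sum.inl a) (Sum.inl b) (Sum.inl tmp)

theorem wp_copyR (hB : (Fintype.card Reg + 10) * (ℓ + 1) + s ≤ B) (hS : Ready ℓ S)
    {f : Bool → Bool} {a b : Reg} (ha : a ∉ scratch) (hb : b ∉ scratch) (hab : a ≠ b)
    {post : Unit → (Reg ⊕ X → List Bool) → Prop}
    (h : post () (update S (Sum.inl b) ((S (Sum.inl a)).map f ++ S (Sum.inl b)))) :
    (copyR f a b).wp B S post := by
  simp only [scratch, List.mem_cons, not_or] at ha hb
  refine wp_copyMap (by simp [hab]) (by simp [ha]) (by simp [hb]) (hS.scratch _ (by decide)) ?_ h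
  have := hS.room hB
  have := hS.short a
  omega

theorem wp_clearR (hB : (Fintype.card Reg + 10) * (ℓ + 1) + s ≤ B) (hS : Ready ℓ S) {a : Reg}
    {post : Unit → (Reg ⊕ X → List Bool) → Prop}
    (h : post () (update S (Sum.inl a) [])) : (clear (Sum.inl a)).wp B S post :=
  wp_clear (by have := hS.room hB; omega) h

/-- Put the number `c` on an empty register. -/
def numeral (a : Reg) (c : ℕ) : Frag (Reg ⊕ X) Unit :=
  forAll (List.replicate c ()) fun _ => incR a

theorem wp_numeral (hB : (Fintype.card Reg + 10) * (ℓ + 1) + s ≤ B) (hS : Ready ℓ S) {a : Reg}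
    (ha : a ∉ scratch) {c c₀ : ℕ} (hc : S (Sum.inl a) = c₀.bits) (hl : c₀ + c < 2 ^ ℓ)
    {post : Unit → (Reg ⊕ X → List Bool) → Prop}
    (h : post () (update S (Sum.inl a) (c₀ + c).bits)) : (numeral a c).wp B S post := by
  induction c generalizing c₀ S with
  | zero =>
    refine wp_pure ?_
    rwa [Nat.add_zero, ← hc, update_eq_self] at h
  | succ c ih =>
    refine wp_bind (wp_incR hB hS ha hc (ih (c₀ := c₀ + 1) (hS.update ha ?_) ?_ ?_ ?_))
    · exact length_bits_le.2 (by omega)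
    · simp
    · omega
    · rw [update_idem]
      convert h using 3
      omega

/-- Test whether the number on `a` is less than that on `b`. -/
def ltR (a b : Reg) : Frag (Reg ⊕ X) Bool :=
  (loop ((eqR z b).bind fun o => if o then Frag.pure (some false) else
    (eqR z a).bind fun o' => if o' then Frag.pure (some true) else
      (incR z).bind fun _ => Frag.pure none)).bind fun o =>
    (clear (Sum.inl z)).bind fun _ => Frag.pure o

/-- `z` counts up until it meets one of the two numbers. This may take exponential time but needs
only one more short register. Testing `b` first gives the answer `false` for equal numbers. -/
theorem wp_ltR (hB : (Fintype.card Reg + 10) * (ℓ + 1) + s ≤ B) (hS : Ready ℓ S) {a b : Reg}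
    (ha : a ∉ scratch) (hb : b ∉ scratch) (haz : a ≠ z) (hbz : b ≠ z)
    {u v : ℕ} (hu : S (Sum.inl a) = u.bits) (hv : S (Sum.inl b) = v.bits)
    (hz : S (Sum.inl z) = []) {post : Bool → (Reg ⊕ X → List Bool) → Prop}
    (h : post (decide (u < v)) S) : (ltR a b).wp B S post := by
  have hu' : u < 2 ^ ℓ := length_bits_le.1 (hu ▸ hS.short a)
  refine wp_bind ?_
  have h0 : S = update S (Sum.inl z) (Nat.bits 0) := by rw [Nat.zero_bits, update_nil hz]
  rw [h0]
  have key : ∀ k c, c + k = min u v → (loop ((eqR z b).bind fun o =>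
      if o then Frag.pure (some false) else (eqR z a).bind fun o' =>
        if o' then Frag.pure (some true) else (incR z).bind fun _ => Frag.pure none)).wp B
      (update S (Sum.inl z) c.bits) fun o S' =>
        ((clear (Sum.inl z)).bind fun _ => Frag.pure o).wp B S' post := by
    intro k
    induction k with
    | zero =>
      intro c hc
      have hS' : Ready ℓ (update S (Sum.inl z) c.bits) :=
        hS.update (by decide) (length_bits_le.2 (by omega))
      have hroom := hS'.room hB
      refine wp_loop (by omega) (wp_bind (wp_eqR hB hS' (by decide) hb ?_))
      simp only [update_self, update_of_ne (Sum.inl_injective.ne hbz), hv, bits_injective.eq_iff]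
      by_cases hcv : c = v
      · simp only [hcv, decide_true, if_true]
        refine wp_pure (wp_bind (wp_clearR hB (hcv ▸ hS') (wp_pure ?_)))
        rw [update_idem, update_nil hz]
        rwa [decide_eq_false (by omega)] at h
      · simp only [hcv, decide_false, Bool.false_eq_true, if_false]
        refine wp_bind (wp_eqR hB hS' (by decide) ha ?_)
        simp only [update_self, update_of_ne (Sum.inl_injective.ne haz), hu, bits_injective.eq_iff]
        have hcu : c = u := by omega
        simp only [hcu, decide_true, if_true]
        refine wp_pure (wp_bind (wp_clearR hB (hcu ▸ hS') (wp_pure ?_)))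
        rw [update_idem, update_nil hz]
        rwa [decide_eq_true (by omega)] at h
    | succ k ih =>
      intro c hc
      have hS' : Ready ℓ (update S (Sum.inl z) c.bits) :=
        hS.update (by decide) (length_bits_le.2 (by omega))
      have hroom := hS'.room hB
      refine wp_loop (by omega) (wp_bind (wp_eqR hB hS' (by decide) hb ?_))
      simp only [update_self, update_of_ne (Sum.inl_injective.ne hbz), hv, bits_injective.eq_iff,
        show c ≠ v by omega, decide_false, Bool.false_eq_true, if_false]
      refine wp_bind (wp_eqR hB hS' (by decide) ha ?_)
      simp only [update_self, update_of_ne (Sum.inl_injective.ne haz), hu, bits_injective.eq_iff,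
        show c ≠ u by omega, decide_false, Bool.false_eq_true, if_false]
      refine wp_bind (wp_incR hB hS' (by decide) (update_self _ _ _) (wp_pure ?_))
      rw [update_idem]
      exact ih (c + 1) (by omega)
  exact key (min u v) 0 (by omega)

/-- Divide `num` by `den`, with the quotient on `thr`. -/
def divR : Frag (Reg ⊕ X) Unit :=
  (loop ((eqR z num).bind fun o => if o then Frag.pure (some ()) else
    (incR rem).bind fun _ => (eqR rem den).bind fun o' =>
      (if o' then (clear (Sum.inl rem)).bind fun _ => incR thr else Frag.pure ()).bind fun _ =>
        (incR z).bind fun _ => Frag.pure none)).bind fun _ =>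
    (clear (Sum.inl z)).bind fun _ => clear (Sum.inl rem)

theorem wp_divR (hB : (Fintype.card Reg + 10) * (ℓ + 1) + s ≤ B) (hS : Ready ℓ S)
    {u v : ℕ} (hu : S (Sum.inl num) = u.bits) (hv : S (Sum.inl den) = v.bits) (hv0 : 0 < v)
    (hz : S (Sum.inl z) = []) (hr : S (Sum.inl rem) = []) (ht : S (Sum.inl thr) = [])
    {post : Unit → (Reg ⊕ X → List Bool) → Prop}
    (h : post () (update S (Sum.inl thr) (u / v).bits)) : divR.wp B S post := by
  have hu' : u < 2 ^ ℓ := length_bits_le.1 (hu ▸ hS.short num)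
  have hv' : v < 2 ^ ℓ := length_bits_le.1 (hv ▸ hS.short den)
  refine wp_bind ?_
  -- The loop invariant: when `z` holds `c`, the registers `rem` and `thr` hold the remainder and
  -- the quotient of `c` by `v`.
  set Y : ℕ → Reg ⊕ X → List Bool := fun c =>
    update (update (update S (Sum.inl z) c.bits) (Sum.inl rem) (c % v).bits) (Sum.inl thr)
      (c / v).bits with hY
  have h0 : S = Y 0 := by
    simp only [hY, Nat.zero_bits, Nat.zero_mod, Nat.zero_div]
    rw [update_nil hz, update_nil hr, update_nil ht]
  have hYR : ∀ c ≤ u, Ready ℓ (Y c) := by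
    intro c hc
    refine ((hS.update (by decide) (length_bits_le.2 (by omega))).update (by decide)
      (length_bits_le.2 ?_)).update (by decide) (length_bits_le.2 ?_)
    · exact (Nat.mod_lt _ hv0).trans hv'
    · exact (Nat.div_le_self _ _).trans_lt (by omega)
  rw [h0]
  have key : ∀ k c, c + k = u → (loop ((eqR z num).bind fun o => if o then Frag.pure (some ()) else
      (incR rem).bind fun _ => (eqR rem den).bind fun o' =>
      (if o' then (clear (Sum.inl rem)).bind fun _ => incR thr else Frag.pure ()).bind fun _ =>
        (incR z).bind fun _ => Frag.pure none)).wp B (Y c) fun _ S' =>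
        ((clear (Sum.inl z)).bind fun _ => clear (Sum.inl rem)).wp B S' post := by
    intro k
    induction k with
    | zero =>
      intro c hc
      have hS' := hYR c (by omega)
      have hroom := hS'.room hB
      refine wp_loop (by omega) (wp_bind (wp_eqR hB hS' (by decide) (by decide) ?_))
      have h₁ : Y c (Sum.inl z) = c.bits := by simp [hY]
      have h₂ : Y c (Sum.inl num) = u.bits := by simp [hY, hu]
      rw [h₁, h₂, show c = u by omega]
      simp only [decide_true, if_true]
      refine wp_pure (wp_bind (wp_clearR hB (hYR u le_rfl) (wp_clearR hB
        ((hYR u le_rfl).update (by decide) (by simp)) ?_)))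
      convert h using 1
      funext r
      rcases r with r | x
      · cases r <;> simp [hY, hz, hr]
      · simp [hY]
    | succ k ih =>
      intro c hc
      have hS' := hYR c (by omega)
      have hroom := hS'.room hB
      refine wp_loop (by omega) (wp_bind (wp_eqR hB hS' (by decide) (by decide) ?_))
      have h₁ : Y c (Sum.inl z) = c.bits := by simp [hY]
      have h₂ : Y c (Sum.inl num) = u.bits := by simp [hY, hu]
      have h₃ : Y c (Sum.inl rem) = (c % v).bits := by simp [hY]
      have h₄ : Y c (Sum.inl den) = v.bits := by simp [hY, hv]
      have h₅ : Y c (Sum.inl thr) = (c / v).bits := by simp [hY]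
      have hmod := Nat.mod_lt c hv0
      simp only [h₁, h₂, bits_injective.eq_iff, show c ≠ u by omega, decide_false,
        Bool.false_eq_true, if_false]
      refine wp_bind (wp_incR hB hS' (by decide) h₃ ?_)
      have hS₁ : Ready ℓ (update (Y c) (Sum.inl rem) (c % v + 1).bits) :=
        hS'.update (by decide) (length_bits_le.2 (by omega))
      refine wp_bind (wp_eqR hB hS₁ (by decide) (by decide) ?_)
      rw [update_self, update_of_ne (by simp), h₄]
      have hdm := Nat.div_add_mod c v
      by_cases hcv : c % v + 1 = v
      · have hc1 : c + 1 = v * (c / v + 1) := by rw [mul_add]; omega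
        have hm1 : (c + 1) % v = 0 := by rw [hc1]; simp
        have hd1 : (c + 1) / v = c / v + 1 := by rw [hc1]; exact Nat.mul_div_cancel_left _ hv0
        simp only [hcv, decide_true, if_true]
        rw [hcv] at hS₁
        refine wp_bind (wp_bind (wp_clearR hB hS₁ ?_))
        rw [update_idem]
        have hS₂ : Ready ℓ (update (Y c) (Sum.inl rem) []) := hS'.update (by decide) (by simp)
        refine wp_incR hB hS₂ (by decide) (c := c / v) (by simp [h₅]) ?_
        have hS₃ : Ready ℓ (update (update (Y c) (Sum.inl rem) []) (Sum.inl thr)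
            (c / v + 1).bits) := hS₂.update (by decide) (length_bits_le.2 (by
              have := Nat.div_le_self (c + 1) v; omega))
        refine wp_bind (wp_incR hB hS₃ (by decide) (c := c) (by simp [h₁]) (wp_pure ?_))
        have := ih (c + 1) (by omega)
        simp only [Option.elim_none]
        convert this using 1
        funext r
        rcases r with r | x
        · cases r <;> simp [hY, hm1, hd1]
        · simp [hY]
      · have hc1 : c + 1 = v * (c / v) + (c % v + 1) := by omega
        have hm1 : (c + 1) % v = c % v + 1 := by
          have : c % v + 1 < v := by omega
          rw [hc1, Nat.mul_add_mod, Nat.mod_eq_of_lt this]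
        have hd1 : (c + 1) / v = c / v := by
          have : c % v + 1 < v := by omega
          rw [hc1, Nat.mul_add_div hv0, Nat.div_eq_of_lt this, Nat.add_zero]
        simp only [bits_injective.eq_iff, hcv, decide_false, Bool.false_eq_true, if_false]
        refine wp_bind (wp_pure (wp_bind (wp_incR hB hS₁ (by decide) (c := c) (by simp [h₁])
          (wp_pure ?_))))
        have := ih (c + 1) (by omega)
        simp only [Option.elim_none]
        convert this using 1
        funext r
        rcases r with r | x
        · cases r <;> simp [hY, hm1, hd1]
        · simp [hY]
  exact key u 0 (by omega)

end Basic

end Frag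

end

/-! ### Edge counts along a list and the data of a run -/

theorem Machine.ComputesInSpace.mono {a : ℕ} {T : Machine a} {input : Fin a → List Bool}
    {output : List Bool} {s s' : ℕ} (h : T.ComputesInSpace input output s) (hs : s ≤ s') :
    T.ComputesInSpace input output s' :=
  ⟨h.1, fun c hc => (h.2 c hc).trans (by omega)⟩

/-- The number of edges from `x` to `w`. -/
def edgeCount {p : Params} (G : Graph p) (x : Str p.n) (w : Str p.m) : ℕ :=
  (Finset.univ.filter fun e => G x e = w).card

/-- The number of edges from the vertices of the list `l` to `w`. -/
def listEdgeCount {p : Params} (G : Graph p) (l : List (Str p.n)) (w : Str p.m) : ℕ :=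
  (l.map fun x => edgeCount G x w).sum

theorem edgeCount_le {p : Params} (G : Graph p) (x : Str p.n) (w : Str p.m) :
    edgeCount G x w ≤ 2 ^ p.d :=
  (Finset.card_filter_le _ _).trans (by simp)

theorem listEdgeCount_le {p : Params} (G : Graph p) (l : List (Str p.n)) (w : Str p.m) :
    listEdgeCount G l w ≤ l.length * 2 ^ p.d := by
  refine (List.sum_le_card_nsmul _ (2 ^ p.d) ?_).trans (by simp)
  simp only [List.mem_map]
  rintro _ ⟨x, _, rfl⟩
  exact edgeCount_le G x w

theorem listEdgeCount_take_succ {p : Params} (G : Graph p) (l : List (Str p.n)) (w : Str p.m)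
    {v : ℕ} (hv : v < l.length) :
    listEdgeCount G (l.take (v + 1)) w = listEdgeCount G (l.take v) w + edgeCount G l[v] w := by
  rw [listEdgeCount, List.take_add_one, List.getElem?_eq_getElem hv, List.map_append,
    List.sum_append]
  simp only [Option.toList_some, List.map_cons, List.map_nil, List.sum_cons, List.sum_nil,
    Nat.add_zero, listEdgeCount]

/-- Every neighbour of `x` receives more than `θ` edges from the list `l`. -/
def allAbove {p : Params} (G : Graph p) (l : List (Str p.n)) (θ : ℕ) (x : Str p.n) : Prop :=
  ∀ e, θ < listEdgeCount G l (G x e)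

instance {p : Params} (G : Graph p) (l : List (Str p.n)) (θ : ℕ) :
    DecidablePred (allAbove G l θ) := fun _ => Fintype.decidableForallFintype

theorem ofFn_injective {n : ℕ} : Injective (List.ofFn : Str n → List Bool) :=
  List.ofFn_injective

section Registers

variable {X : Type} [DecidableEq X] {S : Reg ⊕ X → List Bool}

theorem nil_update {rs : List Reg} (h : ∀ r ∈ rs, S (Sum.inl r) = []) {r₀ : Reg} (h₀ : r₀ ∉ rs)
    {v : List Bool} : ∀ r ∈ rs, update S (Sum.inl r₀) v (Sum.inl r) = [] := by
  intro r hr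
  rw [update_of_ne, h r hr]
  intro hrr
  exact h₀ (Sum.inl.inj hrr ▸ hr)

/-- The input registers hold the input of the program. -/
def Env (p : Params) (ib jb : List Bool) (S : Reg ⊕ X → List Bool) : Prop :=
  ∀ t, S (Sum.inl (.inp t)) = inputs p ib jb t

theorem Env.update {p : Params} {ib jb : List Bool} (h : Env p ib jb S) {r : Reg}
    (hr : ∀ t, r ≠ .inp t) {v : List Bool} : Env p ib jb (update S (Sum.inl r) v) := by
  intro t
  rw [update_of_ne (fun h => hr t (Sum.inl.inj h).symm), h t]

end Registers

/-- The data of a run: `T` enumerates `l` as the set with index `ib`, `U` computes `G`, and `ℓ` and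
`B` are large enough. -/
structure Setup (T U : Machine 6) {p : Params} (G : Graph p) (l : List (Str p.n))
    (ib : List Bool) (ℓ s B : ℕ) : Prop where
  fetch : ∀ v ≤ l.length, T.ComputesInSpace (inputs p ib v.bits) (encodeAnswer l[v]?) s
  edge : ∀ x e, U.ComputesInSpace (inputs p (List.ofFn x) (List.ofFn e)) (List.ofFn (G x e)) s
  room : (Fintype.card Reg + 10) * (ℓ + 1) + s ≤ B
  le_n : p.n + 1 ≤ ℓ
  le_m : p.m ≤ ℓ
  le_d : p.d ≤ ℓ
  volume : l.length * 2 ^ p.d + l.length + 1 < 2 ^ ℓ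

/-! ### The program that searches for congested vertices -/

namespace Frag

open Reg

variable (T U : Machine 6)

/-- The stacks of the program: its registers and the stacks of the two machines it calls. -/
abbrev Stacks : Type := Reg ⊕ ((Fin 6 ⊕ T.W) ⊕ (Fin 6 ⊕ U.W))

noncomputable def fetch (r a : Reg) : Frag (Stacks T U) Unit :=
  call T (fun k => Sum.inr (Sum.inl k))
    (fun t => Sum.inl (![inp 0, inp 1, inp 2, inp 3, inp 4, r] t)) (Sum.inl a) (Sum.inl tmp)

noncomputable def edge (r r' a : Reg) : Frag (Stacks T U) Unit :=
  call U (fun k => Sum.inr (Sum.inr k))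
    (fun t => Sum.inl (![inp 0, inp 1, inp 2, inp 3, r, r'] t)) (Sum.inl a) (Sum.inl tmp)

/-- Add to `cnt` the number of edges from the vertex `x'` to the vertex `y`. -/
noncomputable def countEdges : Frag (Stacks T U) Unit :=
  forStr (Sum.inl (inp 2)) (Sum.inl e') (Sum.inl tmp)
    ((edge T U x' e' y').bind fun _ => (eqR y y').bind fun o =>
      (clear (Sum.inl y')).bind fun _ => if o then incR cnt else Frag.pure ())

/-- Test whether the vertex `y` receives more edges than the number on `thr`. -/
noncomputable def clotTest : Frag (Stacks T U) Bool :=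
  (forList (fetch T U idx' x') (Sum.inl idx') (Sum.inl x') (Sum.inl tmp) (countEdges T U)).bind
    fun _ => (ltR thr cnt).bind fun o => (clear (Sum.inl cnt)).bind fun _ => Frag.pure o

/-- Test whether the vertex `x` is congested. -/
noncomputable def congestedTest : Frag (Stacks T U) Bool :=
  (push (Sum.inl ok) true).bind fun _ =>
    (forStr (Sum.inl (inp 2)) (Sum.inl e) (Sum.inl tmp)
      ((edge T U x e y).bind fun _ => (clotTest T U).bind fun o =>
        (clear (Sum.inl y)).bind fun _ => if o then Frag.pure () else clear (Sum.inl ok))).bind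
    fun _ => (pop (Sum.inl ok)).bind fun o => Frag.pure o.isSome

/-- Write to `out` the answer to the query `inp 5` about the congested vertices. -/
noncomputable def search : Frag (Stacks T U) Unit :=
  forList (fetch T U idx x) (Sum.inl idx) (Sum.inl x) (Sum.inl tmp)
    ((congestedTest T U).bind fun o => if o then
      (eqR hit (inp 5)).bind fun o' =>
        (if o' then (copyR id x out).bind fun _ => push (Sum.inl out) true
          else Frag.pure ()).bind fun _ => incR hit
      else Frag.pure ())

/-- Put the number `⌊u * 2 ^ (d + k) / (v * 2 ^ m)⌋` on `thr`. -/
def threshold (u v : ℕ) : Frag (Stacks T U) Unit :=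
  (numeral num u).bind fun _ => (copyR (fun _ => false) (inp 2) num).bind fun _ =>
    (copyR (fun _ => false) (inp 3) num).bind fun _ => (numeral den v).bind fun _ =>
      (copyR (fun _ => false) (inp 1) den).bind fun _ => divR

variable {T U} {p : Params} {G : Graph p} {l : List (Str p.n)} {ib jb : List Bool} {ℓ s B : ℕ}
  {S : Stacks T U → List Bool}

theorem args_eq {p : Params} {ib jb u v : List Bool} {S : Stacks T U → List Bool}
    (hE : Env p ib jb S) {r r' : Reg} (hr : S (Sum.inl r) = u) (hr' : S (Sum.inl r') = v) :
    (fun t => S (Sum.inl (![inp 0, inp 1, inp 2, inp 3, r, r'] t))) = inputs p u v := by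
  have h₀ : S (Sum.inl (inp 0)) = List.replicate p.n true := hE 0
  have h₁ : S (Sum.inl (inp 1)) = List.replicate p.m true := hE 1
  have h₂ : S (Sum.inl (inp 2)) = List.replicate p.d true := hE 2
  have h₃ : S (Sum.inl (inp 3)) = List.replicate p.k true := hE 3
  funext t
  fin_cases t <;> simp [inputs, h₀, h₁, h₂, h₃, hr, hr']

theorem wp_callR {M : Machine 6} {g : Fin 6 ⊕ M.W → Stacks T U} (hg : Injective g)
    (hgr : ∀ x r, (Sum.inl r : Stacks T U) ≠ g x) (hgs : ∀ x, ∃ k, g x = Sum.inr k)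
    (hB : (Fintype.card Reg + 10) * (ℓ + 1) + s ≤ B) (hS : Ready ℓ S) (hE : Env p ib jb S)
    {r r' res : Reg} {u v output : List Bool} (hr : S (Sum.inl r) = u) (hr' : S (Sum.inl r') = v)
    (hsr : r ∉ scratch) (hsr' : r' ∉ scratch) (hres : res ∉ scratch)
    (hM : M.ComputesInSpace (inputs p u v) output s) (hn : S (Sum.inl res) = [])
    {post : Unit → (Stacks T U → List Bool) → Prop} (h : post () (update S (Sum.inl res) output)) :
    (call M g (fun t => Sum.inl (![inp 0, inp 1, inp 2, inp 3, r, r'] t)) (Sum.inl res)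
      (Sum.inl tmp)).wp B S post := by
  simp only [scratch, List.mem_cons, not_or] at hsr hsr' hres
  refine wp_call hg (fun x t => hgr _ _) (fun x => hgr _ _) (fun x => hgr _ _) ?_
    (by simp [hres]) (s := s) (output := output) ?_ ?_ hn (hS.scratch _ (by decide)) ?_ h
  · intro t
    fin_cases t <;> simp [hsr, hsr']
  · rwa [args_eq hE hr hr']
  · intro x
    obtain ⟨k, hk⟩ := hgs x
    rw [hk, hS.empty]
  · have h₁ := hS.room hB
    have h₂ : ∑ t, (S (Sum.inl (![inp 0, inp 1, inp 2, inp 3, r, r'] t))).length ≤ 6 * ℓ :=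
      (Finset.sum_le_sum fun t _ => hS.short _).trans (by simp)
    refine (Nat.add_le_add_right (Nat.add_le_add_left h₂ _) _).trans ?_
    omega

theorem wp_fetch (H : Setup T U G l ib ℓ s B) (hS : Ready ℓ S) (hE : Env p ib jb S)
    {r a : Reg} (hr : r ∉ scratch) (ha : a ∉ scratch) {v : ℕ} (hv : v ≤ l.length)
    (hrv : S (Sum.inl r) = v.bits) (hn : S (Sum.inl a) = [])
    {post : Unit → (Stacks T U → List Bool) → Prop}
    (h : post () (update S (Sum.inl a) (encodeAnswer l[v]?))) :
    (fetch T U r a).wp B S post :=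
  wp_callR (fun _ _ h => by simpa using h) (by simp) (fun x => ⟨_, rfl⟩) H.room hS hE (hE 4) hrv
    (by decide) hr ha (H.fetch v hv) hn h

theorem wp_edge (H : Setup T U G l ib ℓ s B) (hS : Ready ℓ S) (hE : Env p ib jb S)
    {r r' res : Reg} (hr : r ∉ scratch) (hr' : r' ∉ scratch) (hres : res ∉ scratch)
    {a : Str p.n} {b : Str p.d} (hra : S (Sum.inl r) = List.ofFn a)
    (hrb : S (Sum.inl r') = List.ofFn b) (hn : S (Sum.inl res) = [])
    {post : Unit → (Stacks T U → List Bool) → Prop}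
    (h : post () (update S (Sum.inl res) (List.ofFn (G a b)))) : (edge T U r r' res).wp B S post :=
  wp_callR (fun _ _ h => by simpa using h) (by simp) (fun x => ⟨_, rfl⟩) H.room hS hE hra hrb
    hr hr' hres (H.edge a b) hn h

theorem card_filter_range_succ (P : ℕ → Prop) [DecidablePred P] (v : ℕ) :
    ((Finset.range (v + 1)).filter P).card =
      ((Finset.range v).filter P).card + if P v then 1 else 0 := by
  rw [Finset.range_add_one, Finset.filter_insert]
  split_ifs <;> simp

theorem wp_countEdges (H : Setup T U G l ib ℓ s B) (hS : Ready ℓ S) (hE : Env p ib jb S)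
    (hn : ∀ r ∈ [e', y'], S (Sum.inl r) = []) {a : Str p.n} {w : Str p.m}
    (hx : S (Sum.inl x') = List.ofFn a) (hy : S (Sum.inl y) = List.ofFn w) {c : ℕ}
    (hc : S (Sum.inl cnt) = c.bits) (hcl : c + 2 ^ p.d < 2 ^ ℓ)
    {post : Unit → (Stacks T U → List Bool) → Prop}
    (h : post () (update S (Sum.inl cnt) (c + edgeCount G a w).bits)) :
    (countEdges T U).wp B S post := by
  -- The invariant: `cnt` has grown by the number of edges to `w` among the first `v` edges of `a`.
  set N : ℕ → ℕ := fun v =>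
    ((Finset.range v).filter fun i => G a (strOf p.d i) = w).card with hN
  set Y : ℕ → Stacks T U → List Bool := fun v =>
    update S (Sum.inl cnt) (c + N v).bits with hY
  have hNv : ∀ v, N v ≤ v := fun v => (Finset.card_filter_le _ _).trans (by simp)
  have hYR : ∀ v ≤ 2 ^ p.d, Ready ℓ (Y v) := fun v hv =>
    hS.update (by decide) (length_bits_le.2 (by have := hNv v; omega))
  have hY0 : Y 0 = S := by simp [hY, hN, ← hc]
  have hYe : ∀ v, Y v (Sum.inl e') = [] := fun v => by simp [hY, hn]
  rw [← hY0]
  refine wp_forStr (by simp) (by simp) (by simp) (D := p.d) ?_ (fun v _ => hYe v)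
    (fun v hv => (hYR v hv).scratch _ (by decide)) (fun v hv => ?_) (fun v hv post h => ?_) ?_
  · rw [hY0, hE 2]; simp [inputs]
  · have := (hYR v hv).room H.room
    have := H.le_d
    omega
  · have hd := length_binStr p.d v
    have h₁ : Ready ℓ (update (Y v) (Sum.inl e') (binStr p.d v)) :=
      (hYR v hv.le).update (by decide) (hd.le.trans H.le_d)
    refine wp_bind (wp_edge H h₁ ((hE.update (by simp)).update (by simp)) (by decide) (by decide)
      (by decide) (a := a) (b := strOf p.d v) (by simp [hY, hx]) (by simp [binStr])
      (by simp [hY, hn]) ?_)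
    have h₂ := h₁.update (r := y') (v := List.ofFn (G a (strOf p.d v))) (by decide)
      (by simpa using H.le_m)
    refine wp_bind (wp_eqR H.room h₂ (by decide) (by decide) ?_)
    refine wp_bind (wp_clearR H.room h₂ ?_)
    rw [update_idem, update_nil (by simp [hY, hn])]
    have hyw : update (update (Y v) (Sum.inl e') (binStr p.d v)) (Sum.inl y')
        (List.ofFn (G a (strOf p.d v))) (Sum.inl y) = List.ofFn w := by simp [hY, hy]
    rw [hyw, update_self]
    simp only [ofFn_injective.eq_iff]
    by_cases hw : G a (strOf p.d v) = w
    · have hN1 : N (v + 1) = N v + 1 := by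
        simp only [hN]; rw [card_filter_range_succ, if_pos hw]
      simp only [hw, decide_true, if_true]
      refine wp_incR H.room h₁ (by decide) (c := c + N v) (by simp [hY]) ?_
      convert h using 1
      rw [update_update_comm_of_ne (by simp)]
      simp only [hY, update_idem, hN1, add_assoc]
    · have hN1 : N (v + 1) = N v := by
        simp only [hN]; rw [card_filter_range_succ, if_neg hw, Nat.add_zero]
      simp only [Ne.symm hw, decide_false, Bool.false_eq_true, if_false]
      refine wp_pure ?_
      simpa only [hY, hN1] using h
  · have : N (2 ^ p.d) = edgeCount G a w := card_filter_strOf p.d fun e => G a e = w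
    simpa only [hY, this] using h

/-- The `v`-th element of the list `l` as a list of bits. -/
def listString {n : ℕ} (l : List (Str n)) (v : ℕ) : List Bool := l[v]?.elim [] List.ofFn

theorem length_listString_le {n : ℕ} (l : List (Str n)) (v : ℕ) :
    (listString l v).length ≤ n := by
  unfold listString
  cases l[v]? <;> simp

theorem listString_of_lt {n : ℕ} {l : List (Str n)} {v : ℕ} (hv : v < l.length) :
    listString l v = List.ofFn l[v] := by
  simp [listString, hv]

theorem encodeAnswer_getElem? {n : ℕ} (l : List (Str n)) (v : ℕ) :
    encodeAnswer l[v]? = if v < l.length then true :: (listString l v) else [] := by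
  by_cases hv : v < l.length
  · simp [hv, encodeAnswer, listString]
  · rw [if_neg hv, List.getElem?_eq_none (by omega)]; rfl

/-- Nothing about the clot is stored: the whole list is fetched anew for each `y`. The memory is
restored at the exit, so the test can be used inside other loops. -/
theorem wp_clotTest (H : Setup T U G l ib ℓ s B) (hS : Ready ℓ S) (hE : Env p ib jb S)
    (hn : ∀ r ∈ [idx', x', e', y', cnt, z], S (Sum.inl r) = []) {w : Str p.m} {θ : ℕ}
    (hy : S (Sum.inl y) = List.ofFn w) (hθ : S (Sum.inl thr) = θ.bits)
    {post : Bool → (Stacks T U → List Bool) → Prop}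
    (h : post (decide (θ < listEdgeCount G l w)) S) : (clotTest T U).wp B S post := by
  set N : ℕ → ℕ := fun v => listEdgeCount G (l.take v) w with hN
  set Y : ℕ → Stacks T U → List Bool := fun v => update S (Sum.inl cnt) (N v).bits with hY
  have hvol := H.volume
  have hNv : ∀ v ≤ l.length, N v ≤ v * 2 ^ p.d := fun v hv =>
    (listEdgeCount_le G _ w).trans (by rw [List.length_take, min_eq_left hv])
  have hNv' : ∀ v ≤ l.length, N v < 2 ^ ℓ := fun v hv => by
    have := hNv v hv
    have := Nat.mul_le_mul_right (2 ^ p.d) hv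
    omega
  have hYR : ∀ v ≤ l.length, Ready ℓ (Y v) := fun v hv =>
    hS.update (by decide) (length_bits_le.2 (hNv' v hv))
  have hY0 : Y 0 = S := by
    simp only [hY, hN, List.take_zero, listEdgeCount, List.map_nil, List.sum_nil, Nat.zero_bits]
    exact update_nil (hn _ (by simp))
  have hbits : ∀ v ≤ l.length, (Nat.bits v).length ≤ ℓ := fun v hv =>
    length_bits_le.2 (by omega)
  have hA := length_listString_le l
  refine wp_bind ?_
  rw [← hY0]
  refine wp_forList (by simp) (by simp) (ℓ := ℓ) (N := l.length)
    (A := listString l) (fun v _ => by simp [hY, hn])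
    (fun v _ => by simp [hY, hn]) (fun v hv => (hYR v hv).scratch _ (by decide)) hbits
    (fun v hv => (hA v).trans (by have := H.le_n; omega)) (fun v hv => ?_)
    (fun v hv post h => ?_) (fun v hv post h => ?_) ?_
  · have := (hYR v hv).room H.room
    omega
  · refine wp_fetch H ((hYR v hv).update (by decide) (hbits v hv))
      ((hE.update (by simp)).update (by simp)) (by decide) (by decide) hv (by simp)
      (by simp [hY, hn]) ?_
    rwa [encodeAnswer_getElem?]
  · have h₁ : Ready ℓ (update (update (Y v) (Sum.inl idx') v.bits) (Sum.inl x')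
        (listString l v)) :=
      ((hYR v hv.le).update (by decide) (hbits v hv.le)).update (by decide)
        ((hA v).trans (by have := H.le_n; omega))
    refine wp_countEdges H h₁ (((hE.update (by simp)).update (by simp)).update (by simp))
      (a := l[v]) (w := w) (c := N v) ?_ (by simp [listString_of_lt hv]) (by simp [hY, hy]) (by simp [hY]) ?_ ?_
    · exact nil_update (nil_update (nil_update (fun r hr => hn r (by simp at hr ⊢; tauto))
        (by decide)) (by decide)) (by decide)
    · have h₁ := hNv v hv.le
      have h₂ := Nat.mul_le_mul_right (2 ^ p.d) (Nat.succ_le_of_lt hv)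
      rw [Nat.succ_mul] at h₂
      omega
    · convert h using 1
      have : N v + edgeCount G l[v] w = N (v + 1) := (listEdgeCount_take_succ G l w hv).symm
      rw [this]
      funext r
      rcases r with r | r
      · cases r <;> simp [hY]
      · simp [hY]
  · have hl : N l.length = listEdgeCount G l w := by simp only [hN, List.take_length]
    refine wp_bind (wp_ltR H.room (hYR _ le_rfl) (by decide) (by decide) (by decide) (by decide)
      (u := θ) (v := N l.length) (by simp [hY, hθ]) (by simp [hY]) (by simp [hY, hn]) ?_)
    refine wp_bind (wp_clearR H.room (hYR _ le_rfl) (wp_pure ?_))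
    rw [hl]
    simp only [hY, update_idem]
    rwa [update_nil (hn _ (by simp))]

theorem wp_congestedTest (H : Setup T U G l ib ℓ s B) (hS : Ready ℓ S) (hE : Env p ib jb S)
    (hn : ∀ r ∈ [ok, e, y, idx', x', e', y', cnt, z], S (Sum.inl r) = []) {a : Str p.n} {θ : ℕ}
    (hx : S (Sum.inl x) = List.ofFn a) (hθ : S (Sum.inl thr) = θ.bits)
    {post : Bool → (Stacks T U → List Bool) → Prop}
    (h : post (decide (allAbove G l θ a)) S) : (congestedTest T U).wp B S post := by
  set P : ℕ → Prop := fun v => θ < listEdgeCount G l (G a (strOf p.d v)) with hP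
  -- The flag `ok` is nonempty as long as all neighbours tested so far pass; once cleared, it is
  -- never set again.
  set Y : ℕ → Stacks T U → List Bool := fun v =>
    update S (Sum.inl ok) (if ∀ i < v, P i then [true] else []) with hY
  have hYR : ∀ v, Ready ℓ (Y v) := fun v => hS.update (by decide) (by
    have := H.le_n
    split_ifs
    · simp; omega
    · simp)
  refine wp_bind (wp_push (by have := hS.room H.room; omega) ?_)
  have hY0 : update S (Sum.inl ok) (true :: S (Sum.inl ok)) = Y 0 := by simp [hY, hn]
  rw [hY0]
  refine wp_bind (wp_forStr (by simp) (by simp) (by simp) (D := p.d) ?_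
    (fun v _ => by simp [hY, hn]) (fun v hv => (hYR v).scratch _ (by decide)) (fun v hv => ?_)
    (fun v hv post h => ?_) ?_)
  · simp only [hY]
    rw [hE.update (by simp) 2]; simp [inputs]
  · have := (hYR v).room H.room
    have := H.le_d
    omega
  · have hd := length_binStr p.d v
    have h₁ : Ready ℓ (update (Y v) (Sum.inl e) (binStr p.d v)) :=
      (hYR v).update (by decide) (hd.le.trans H.le_d)
    have hE₁ : Env p ib jb (update (Y v) (Sum.inl e) (binStr p.d v)) :=
      (hE.update (by simp)).update (by simp)
    refine wp_bind (wp_edge H h₁ hE₁ (by decide) (by decide)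
      (by decide) (a := a) (b := strOf p.d v) (by simp [hY, hx]) (by simp [binStr])
      (by simp [hY, hn]) ?_)
    have h₂ := h₁.update (r := y) (v := List.ofFn (G a (strOf p.d v))) (by decide)
      (by simpa using H.le_m)
    refine wp_bind (wp_clotTest H h₂ (hE₁.update (by simp)) (w := G a (strOf p.d v)) (θ := θ) ?_
      (by simp) (by simp [hY, hθ]) ?_)
    · exact nil_update (nil_update (nil_update (fun r hr => hn r (by simp at hr ⊢; tauto))
        (by decide)) (by decide)) (by decide)
    refine wp_bind (wp_clearR H.room h₂ ?_)
    rw [update_idem, update_nil (by simp [hY, hn])]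
    have hsucc : (∀ i < v + 1, P i) ↔ (∀ i < v, P i) ∧ P v := Nat.forall_lt_succ_right
    by_cases hPv : P v
    · have hYv : Y (v + 1) = Y v := by
        simp only [hY, hsucc, hPv, and_true]
      have hPv' : θ < listEdgeCount G l (G a (strOf p.d v)) := hPv
      simp only [hPv', decide_true, if_true]
      refine wp_pure ?_
      rwa [← hYv]
    · have hPv' : ¬ θ < listEdgeCount G l (G a (strOf p.d v)) := hPv
      simp only [hPv', decide_false, Bool.false_eq_true, if_false]
      refine wp_clearR H.room h₁ ?_
      convert h using 1
      rw [update_update_comm_of_ne (by simp)]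
      simp only [hY, update_idem, hsucc, hPv, and_false, if_false]
  · have hall : (∀ i < 2 ^ p.d, P i) ↔ allAbove G l θ a :=
      forall_strOf p.d fun b => θ < listEdgeCount G l (G a b)
    refine wp_bind (wp_pop (by have := (hYR (2 ^ p.d)).room H.room; omega) (wp_pure ?_))
    simp only [hY, hall, update_self, update_idem]
    by_cases hal : allAbove G l θ a
    · simp only [hal, if_true, List.head?_cons, List.tail_cons, Option.isSome_some]
      rw [update_nil (hn _ (by simp))]
      rwa [decide_eq_true hal] at h
    · simp only [hal, if_false, List.head?_nil, List.tail_nil, Option.isSome_none]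
      rw [update_nil (hn _ (by simp))]
      rwa [decide_eq_false hal] at h

theorem wp_search (H : Setup T U G l ib ℓ s B) (hS : Ready ℓ S) {j : ℕ}
    (hE : Env p ib j.bits S)
    (hn : ∀ r ∈ [idx, x, hit, out, ok, e, y, idx', x', e', y', cnt, z], S (Sum.inl r) = []) {θ : ℕ}
    (hθ : S (Sum.inl thr) = θ.bits)
    {post : Unit → (Stacks T U → List Bool) → Prop}
    (h : ∀ S', Ready ℓ S' → S' (Sum.inl out) =
      encodeAnswer (l.filter fun x => decide (allAbove G l θ x))[j]? → post () S') :
    (search T U).wp B S post := by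
  set F : ℕ → List (Str p.n) := fun v =>
    (l.take v).filter fun x => decide (allAbove G l θ x) with hF
  -- The invariant: `hit` and `out` are the number of congested vertices and the answer to the query
  -- for the first `v` entries of `l`. The scan does not stop at the answer, but `hit` then exceeds
  -- `j`, so `out` no longer changes.
  set Y : ℕ → Stacks T U → List Bool := fun v =>
    update (update S (Sum.inl hit) (F v).length.bits) (Sum.inl out) (encodeAnswer (F v)[j]?)
    with hY
  have hvol := H.volume
  have hln := H.le_n
  have hFv : ∀ v, (F v).length ≤ l.length := fun v =>
    (List.length_filter_le _ _).trans (by simp)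
  have hans : ∀ o : Option (Str p.n), (encodeAnswer o).length ≤ ℓ := by
    rintro (_ | o) <;> simp [encodeAnswer]
    exact hln
  have hYR : ∀ v, Ready ℓ (Y v) := fun v =>
    (hS.update (by decide) (length_bits_le.2 (by have := hFv v; omega))).update (by decide)
      (hans _)
  have hY0 : Y 0 = S := by
    have h₀ : F 0 = [] := by simp [hF]
    simp only [hY, h₀, List.length_nil, Nat.zero_bits, List.getElem?_nil, encodeAnswer]
    rw [update_nil (hn hit (by simp)), update_nil (hn _ (by simp))]
  have hbits : ∀ v ≤ l.length, (Nat.bits v).length ≤ ℓ := fun v hv =>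
    length_bits_le.2 (by omega)
  have hA : ∀ v, (listString l v).length ≤ ℓ := fun v =>
    (length_listString_le l v).trans (by omega)
  rw [← hY0]
  refine wp_forList (by simp) (by simp) (ℓ := ℓ) (N := l.length)
    (A := listString l) (fun v _ => by simp [hY, hn])
    (fun v _ => by simp [hY, hn]) (fun v hv => (hYR v).scratch _ (by decide)) hbits
    (fun v _ => hA v) (fun v hv => ?_)
    (fun v hv post h => ?_) (fun v hv post h => ?_) ?_
  · have := (hYR v).room H.room
    omega
  · refine wp_fetch H ((hYR v).update (by decide) (hbits v hv))
      (((hE.update (by simp)).update (by simp)).update (by simp)) (by decide) (by decide) hv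
      (by simp) (by simp [hY, hn]) ?_
    rwa [encodeAnswer_getElem?]
  · set S₁ := update (update (Y v) (Sum.inl idx) v.bits) (Sum.inl x)
        (listString l v) with hS₁
    have h₁ : Ready ℓ S₁ :=
      ((hYR v).update (by decide) (hbits v hv.le)).update (by decide) (hA v)
    have hE₁ : Env p ib j.bits S₁ :=
      (((hE.update (by simp)).update (by simp)).update (by simp)).update (by simp)
    have hx₁ : S₁ (Sum.inl x) = List.ofFn l[v] := by simp [hS₁, listString_of_lt hv]
    refine wp_bind (wp_congestedTest H h₁ hE₁ (a := l[v]) (θ := θ) ?_ hx₁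
      (by simp [hS₁, hY, hθ]) ?_)
    · exact nil_update (nil_update (nil_update (nil_update
        (fun r hr => hn r (by simp at hr ⊢; tauto)) (by decide)) (by decide)) (by decide))
        (by decide)
    have htake : l.take (v + 1) = l.take v ++ [l[v]] := by
      rw [List.take_add_one, List.getElem?_eq_getElem hv, Option.toList_some]
    by_cases hal : allAbove G l θ l[v]
    · have hF1 : F (v + 1) = F v ++ [l[v]] := by
        simp only [hF]
        rw [htake, List.filter_append]
        simp [hal]
      simp only [hal, decide_true, if_true]
      refine wp_bind (wp_eqR H.room h₁ (by decide) (by decide) ?_)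
      have hhit : S₁ (Sum.inl hit) = (F v).length.bits := by simp [hS₁, hY]
      have hout : S₁ (Sum.inl out) = encodeAnswer (F v)[j]? := by simp [hS₁, hY]
      have hinp : S₁ (Sum.inl (inp 5)) = j.bits := hE₁ 5
      simp only [hhit, hinp, bits_injective.eq_iff]
      -- Equality means that `l[v]` is the congested vertex with number `j`; up to now the answer
      -- was `none` and `out` was empty.
      by_cases hj : (F v).length = j
      · have ho : (F v)[j]? = none := List.getElem?_eq_none (by omega)
        have ho' : (F (v + 1))[j]? = some l[v] := by rw [hF1, ← hj]; simp
        simp only [hj, decide_true, if_true]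
        refine wp_bind (wp_bind (wp_copyR H.room h₁ (by decide) (by decide) (by decide)
          (wp_push ?_ ?_)))
        · rw [hout, ho, hx₁]
          have h₂ : Ready ℓ (update S₁ (Sum.inl out) (List.map id (List.ofFn l[v]) ++
              encodeAnswer (none : Option (Str p.n)))) := h₁.update (by decide) (by
                simp [encodeAnswer]; omega)
          have := h₂.room H.room
          omega
        rw [update_self, update_idem, hout, ho, hx₁]
        simp only [encodeAnswer, List.map_id, List.append_nil]
        have h₂ : Ready ℓ (update S₁ (Sum.inl out) (true :: List.ofFn l[v])) :=
          h₁.update (by decide) (by simp; omega)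
        refine wp_incR H.room h₂ (by decide) (c := (F v).length) (by simp [hhit]) ?_
        have hl1 : (F (v + 1)).length = (F v).length + 1 := by rw [hF1]; simp
        convert h using 1
        funext r
        rcases r with r | r
        · cases r <;> simp [hY, hS₁, ho', hl1, encodeAnswer]
        · simp [hY, hS₁]
      · simp only [hj, decide_false, Bool.false_eq_true, if_false]
        refine wp_bind (wp_pure (wp_incR H.room h₁ (by decide) hhit ?_))
        have hl1 : (F (v + 1)).length = (F v).length + 1 := by rw [hF1]; simp
        have ho' : (F (v + 1))[j]? = (F v)[j]? := by
          rw [hF1]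
          rcases lt_or_gt_of_ne hj with hj | hj
          · rw [List.getElem?_eq_none (by simp; omega), List.getElem?_eq_none (by omega)]
          · exact List.getElem?_append_left hj
        convert h using 1
        funext r
        rcases r with r | r
        · cases r <;> simp [hY, hS₁, ho', hl1]
        · simp [hY, hS₁]
    · have hF1 : F (v + 1) = F v := by
        simp only [hF]
        rw [htake, List.filter_append]
        simp [hal]
      simp only [hal, decide_false, Bool.false_eq_true, if_false]
      refine wp_pure ?_
      have : Y (v + 1) = Y v := by simp only [hY, hF1]
      rwa [this] at h
  · have hl : F l.length = l.filter fun x => decide (allAbove G l θ x) := by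
      simp only [hF, List.take_length]
    exact h _ (hYR _) (by rw [← hl]; exact update_self _ _ _)

/-- The unary parameters, rewritten as zeros and put before the digits, multiply by $2^d$, $2^k$ and
$2^m$; one integer division follows. -/
theorem wp_threshold (H : Setup T U G l ib ℓ s B) (hS : Ready ℓ S) (hE : Env p ib jb S)
    (hn : ∀ r ∈ [num, den, thr, rem, z], S (Sum.inl r) = []) {u v : ℕ} (hu : u ≠ 0) (hv : v ≠ 0)
    (hul : u * 2 ^ (p.d + p.k) < 2 ^ ℓ) (hvl : v * 2 ^ p.m < 2 ^ ℓ)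
    {post : Unit → (Stacks T U → List Bool) → Prop}
    (h : post () (update (update (update S (Sum.inl num) (u * 2 ^ (p.d + p.k)).bits)
      (Sum.inl den) (v * 2 ^ p.m).bits) (Sum.inl thr)
        (u * 2 ^ (p.d + p.k) / (v * 2 ^ p.m)).bits)) :
    (threshold T U u v).wp B S post := by
  have hd2 : S (Sum.inl (inp 2)) = List.replicate p.d true := hE 2
  have hk2 : S (Sum.inl (inp 3)) = List.replicate p.k true := hE 3
  have hm2 : S (Sum.inl (inp 1)) = List.replicate p.m true := hE 1
  have hud : u * 2 ^ p.d ≤ u * 2 ^ (p.d + p.k) :=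
    Nat.mul_le_mul_left _ (Nat.pow_le_pow_right (by norm_num) (by omega))
  have huu : u ≤ u * 2 ^ p.d := Nat.le_mul_of_pos_right _ (by positivity)
  have hvv : v ≤ v * 2 ^ p.m := Nat.le_mul_of_pos_right _ (by positivity)
  have hR : ∀ c < 2 ^ ℓ, Ready ℓ (update S (Sum.inl num) c.bits) := fun c hc =>
    hS.update (by decide) (length_bits_le.2 hc)
  refine wp_bind (wp_numeral H.room hS (by decide) (c₀ := 0) (by simp [hn]) (by omega) ?_)
  rw [Nat.zero_add]
  refine wp_bind (wp_copyR H.room (hR u (by omega)) (by decide) (by decide) (by decide) ?_)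
  have e₁ : (update S (Sum.inl num) u.bits (Sum.inl (inp 2))).map (fun _ => false) ++
      update S (Sum.inl num) u.bits (Sum.inl num) = (u * 2 ^ p.d).bits := by
    rw [← replicate_append_bits _ _ hu]
    simp [hd2]
  rw [e₁, update_idem]
  refine wp_bind (wp_copyR H.room (hR _ (by omega)) (by decide) (by decide) (by decide) ?_)
  have e₂ : (update S (Sum.inl num) (u * 2 ^ p.d).bits (Sum.inl (inp 3))).map (fun _ => false) ++
      update S (Sum.inl num) (u * 2 ^ p.d).bits (Sum.inl num) = (u * 2 ^ (p.d + p.k)).bits := by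
    rw [pow_add, ← mul_assoc, ← replicate_append_bits _ (u * 2 ^ p.d) (by positivity)]
    simp [hk2]
  rw [e₂, update_idem]
  set S₁ := update S (Sum.inl num) (u * 2 ^ (p.d + p.k)).bits with hS₁
  have hR₁ : Ready ℓ S₁ := hR _ hul
  refine wp_bind (wp_numeral H.room hR₁ (by decide) (c₀ := 0) (by simp [hS₁, hn]) (by omega) ?_)
  rw [Nat.zero_add]
  refine wp_bind (wp_copyR H.room (hR₁.update (by decide) (length_bits_le.2 (by omega)))
    (by decide) (by decide) (by decide) ?_)
  have e₃ : (update S₁ (Sum.inl den) v.bits (Sum.inl (inp 1))).map (fun _ => false) ++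
      update S₁ (Sum.inl den) v.bits (Sum.inl den) = (v * 2 ^ p.m).bits := by
    rw [← replicate_append_bits _ _ hv]
    simp [hS₁, hm2]
  rw [e₃, update_idem]
  refine wp_divR H.room (hR₁.update (by decide) (length_bits_le.2 hvl))
    (u := u * 2 ^ (p.d + p.k)) (v := v * 2 ^ p.m) (by simp [hS₁]) (by simp) (by positivity)
    (by simp [hS₁, hn]) (by simp [hS₁, hn]) (by simp [hS₁, hn]) h

end Frag

/-! ### The enumeration of the congested subsets -/

/-- The register size with which the enumeration of the congested subsets works; `β` bounds the
lengths of the indices. -/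
def registerSize (α : ℚ) (p : Params) (β : ℕ) : ℕ :=
  p.n + p.m + p.d + p.k + β + α.num.natAbs + α.den + 3

/-- The space that the enumeration of the congested subsets needs in addition to that of the
machines it calls. -/
def stepSpace (α : ℚ) (p : Params) (β : ℕ) : ℕ :=
  (Fintype.card Reg + 10) * (registerSize α p β + 1)

/-- The integer part of `α * D * K / M`. -/
def clotThreshold (α : ℚ) (p : Params) : ℕ :=
  α.num.natAbs * 2 ^ (p.d + p.k) / (α.den * 2 ^ p.m)

noncomputable def stepMachine (T U : Machine 6) (α : ℚ) : Machine 6 :=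
  ((Frag.threshold T U α.num.natAbs α.den).bind fun _ => Frag.search T U).toMachine
    (fun t => Sum.inl (Reg.inp t)) (Sum.inl Reg.out)

theorem length_inputs_le (p : Params) (ib jb : List Bool) (β : ℕ) (hi : ib.length ≤ β)
    (hj : jb.length ≤ β) (t : Fin 6) :
    (inputs p ib jb t).length ≤ p.n + p.m + p.d + p.k + β := by
  fin_cases t <;> simp [inputs] <;> omega

/-- The calls to `T` and `U` never overlap, hence `s` is charged once. The index `v = l.length` is
needed to detect the end of the list. -/
theorem stepMachine_computesInSpace {T U : Machine 6} {α : ℚ} (hα : 0 < α) {p : Params}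
    {G : Graph p} {l : List (Str p.n)} (hl : l.length < 2 ^ p.k) {ib : List Bool} {j β s : ℕ}
    (hi : ib.length ≤ β) (hj : j.bits.length ≤ β)
    (hT : ∀ v ≤ l.length, T.ComputesInSpace (inputs p ib v.bits) (encodeAnswer l[v]?) s)
    (hU : ∀ x e, U.ComputesInSpace (inputs p (List.ofFn x) (List.ofFn e))
      (List.ofFn (G x e)) s) :
    (stepMachine T U α).ComputesInSpace (inputs p ib j.bits)
      (encodeAnswer (l.filter fun x => decide (allAbove G l (clotThreshold α p) x))[j]?)
      (s + stepSpace α p β) := by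
  have hinj : Injective fun t => (Sum.inl (Reg.inp t) : Frag.Stacks T U) := by
    intro t t' h
    simpa using h
  refine Frag.computesInSpace_toMachine hinj ?_
  set B := ∑ t, (inputs p ib j.bits t).length + (s + stepSpace α p β) with hB
  set ℓ := registerSize α p β with hℓ
  set u := α.num.natAbs with hu
  set v := α.den with hv
  have hu0 : u ≠ 0 := Int.natAbs_ne_zero.2 (Rat.num_pos.2 hα).ne'
  have hv0 : v ≠ 0 := α.den_nz
  have hℓ' : ℓ = p.n + p.m + p.d + p.k + β + u + v + 3 := rfl
  -- Counters stay below this volume. As `l.length + 1 ≤ 2 ^ p.k`, it is at most twice $2^{k+d}$,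
  -- and the factor `2 ^ 2` makes the inequality strict.
  have hvol : l.length * 2 ^ p.d + l.length + 1 < 2 ^ ℓ := by
    have h₁ : l.length * 2 ^ p.d ≤ 2 ^ p.k * 2 ^ p.d := Nat.mul_le_mul_right _ hl.le
    have h₂ : 2 ^ p.k ≤ 2 ^ p.k * 2 ^ p.d := Nat.le_mul_of_pos_right _ (by positivity)
    have h₃ : 2 ^ p.k * 2 ^ p.d * 2 ^ 2 ≤ 2 ^ ℓ := by
      rw [← pow_add, ← pow_add]
      exact Nat.pow_le_pow_right (by norm_num) (by omega)
    have h₄ : 0 < 2 ^ p.k := by positivity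
    omega
  have H : Setup T U G l ib ℓ s B :=
    { fetch := hT
      edge := hU
      room := by simp only [hB, stepSpace, ← hℓ]; omega
      le_n := by omega
      le_m := by omega
      le_d := by omega
      volume := hvol }
  have hul : u * 2 ^ (p.d + p.k) < 2 ^ ℓ := by
    calc u * 2 ^ (p.d + p.k) < 2 ^ u * 2 ^ (p.d + p.k) :=
          Nat.mul_lt_mul_of_pos_right Nat.lt_two_pow_self (by positivity)
      _ ≤ 2 ^ ℓ := by
        rw [← pow_add]
        exact Nat.pow_le_pow_right (by norm_num) (by omega)
  have hvl : v * 2 ^ p.m < 2 ^ ℓ := by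
    calc v * 2 ^ p.m < 2 ^ v * 2 ^ p.m :=
          Nat.mul_lt_mul_of_pos_right Nat.lt_two_pow_self (by positivity)
      _ ≤ 2 ^ ℓ := by
        rw [← pow_add]
        exact Nat.pow_le_pow_right (by norm_num) (by omega)
  set S : Frag.Stacks T U → List Bool :=
    extend (fun t => Sum.inl (Reg.inp t)) (inputs p ib j.bits) fun _ => [] with hSdef
  have hE : Env p ib j.bits S := fun t => hinj.extend_apply _ _ t
  have hn : ∀ r, (∀ t, r ≠ Reg.inp t) → S (Sum.inl r) = [] := fun r hr =>
    extend_apply' _ _ _ (by rintro ⟨t, ht⟩; exact hr t (Sum.inl.inj ht).symm)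
  have hS : Ready ℓ S :=
    { short := by
        intro r
        by_cases hr : ∃ t, r = Reg.inp t
        · obtain ⟨t, rfl⟩ := hr
          rw [hE t]
          exact (length_inputs_le p _ _ β hi hj t).trans (by omega)
        · rw [hn r fun t ht => hr ⟨t, ht⟩]; simp
      empty := fun x => extend_apply' _ _ _ (by rintro ⟨t, ht⟩; simp at ht)
      scratch := fun r hr => hn r (by rintro t rfl; simp [Reg.scratch] at hr) }
  refine Frag.wp_bind (Frag.wp_threshold H hS hE (fun r hr => hn r ?_) hu0 hv0 hul hvl ?_)
  · rintro t rfl; simp at hr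
  have hθ : u * 2 ^ (p.d + p.k) / (v * 2 ^ p.m) < 2 ^ ℓ := (Nat.div_le_self _ _).trans_lt hul
  have hS' := ((hS.update (r := Reg.num) (by decide) (length_bits_le.2 hul)).update
    (r := Reg.den) (by decide) (length_bits_le.2 hvl)).update (r := Reg.thr) (by decide)
    (length_bits_le.2 hθ)
  refine Frag.wp_search H hS' (((hE.update (by simp)).update (by simp)).update (by simp)) ?_
    (update_self _ _ _) fun S' h₁ h₂ => ⟨h₂, ?_⟩
  · refine nil_update (nil_update (nil_update (fun r hr => hn r ?_) (by decide)) (by decide))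
      (by decide)
    rintro t rfl; simp at hr
  · have := h₁.room H.room
    omega

/-! ### The integer threshold, the clot and iteration -/

/-- An integer exceeds a nonnegative rational exactly when it exceeds its integer part; the rest is
clearing the denominator of `α`. -/
theorem clotThreshold_lt_iff {α : ℚ} (hα : 0 < α) (p : Params) (c : ℕ) :
    clotThreshold α p < c ↔ α * 2 ^ p.d * 2 ^ p.k / 2 ^ p.m < (c : ℚ) := by
  have hnum : (α.num.natAbs : ℚ) = α.num := by
    rw [← Int.cast_natCast, Int.natAbs_of_nonneg (Rat.num_pos.2 hα).le]
  have hden : (0 : ℚ) < α.den := by exact_mod_cast α.den_pos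
  have hd : 0 < α.den * 2 ^ p.m := Nat.mul_pos α.den_pos (by positivity)
  have h2 : (0 : ℚ) < 2 ^ p.m := by positivity
  rw [clotThreshold, Nat.div_lt_iff_lt_mul hd, div_lt_iff₀ h2]
  have hα' : α * α.den = α.num := Rat.mul_den_eq_num α
  rw [← Nat.cast_lt (α := ℚ)]
  push_cast
  rw [hnum, ← hα', pow_add]
  constructor
  · intro h
    refine lt_of_mul_lt_mul_left ?_ hden.le
    calc _ = α * α.den * (2 ^ p.d * 2 ^ p.k) := by ring
      _ < _ := h
      _ = _ := by ring
  · intro h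
    calc _ = α.den * (α * 2 ^ p.d * 2 ^ p.k) := by ring
      _ < α.den * (c * 2 ^ p.m) := mul_lt_mul_of_pos_left h hden
      _ = _ := by ring

/-- Without `Nodup`, edges of repeated vertices would be counted several times. -/
theorem listEdgeCount_eq_card {p : Params} (G : Graph p) {l : List (Str p.n)} (hl : l.Nodup)
    (w : Str p.m) : listEdgeCount G l w =
      ((l.toFinset ×ˢ (Finset.univ : Finset (Str p.d))).filter
        fun xe => G xe.1 xe.2 = w).card := by
  rw [listEdgeCount, ← List.sum_toFinset _ hl, Finset.card_filter, Finset.sum_product]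
  refine Finset.sum_congr rfl fun x _ => ?_
  rw [edgeCount, Finset.card_filter]

theorem toFinset_filter_allAbove {α : ℚ} (hα : 0 < α) {p : Params} (G : Graph p)
    {l : List (Str p.n)} (hl : l.Nodup) :
    (l.filter fun x => decide (allAbove G l (clotThreshold α p) x)).toFinset =
      congested α G l.toFinset := by
  classical
  ext x
  unfold congested
  rw [List.mem_toFinset, List.mem_filter, Finset.mem_filter, List.mem_toFinset]
  simp only [decide_eq_true_eq, allAbove, InClot, clotThreshold_lt_iff hα,
    listEdgeCount_eq_card G hl]

/-- As `EnumerableInSpace`, but only for indices with at most `β` digits. -/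
def EnumerableBelow (β : Params → ℕ) (a : ℕ) (P : Set Params) (𝒮 : ∀ p, SetSystem p)
    (s : Params → ℕ) : Prop :=
  ∃ T : Machine 6, ∀ p ∈ P, ∃ L : List (List (Str p.n)),
    L.length ≤ 2 ^ (a * p.n) ∧
    (∀ l ∈ L, l.Nodup) ∧
    𝒮 p = {S | ∃ l ∈ L, S = l.toFinset} ∧
    ∀ i j : ℕ, i.bits.length ≤ β p → j.bits.length ≤ β p →
      T.ComputesInSpace (inputs p (Nat.bits i) (Nat.bits j))
        (encodeAnswer (L[i]?.bind fun l => l[j]?)) (s p)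

theorem EnumerableInSpace.enumerableBelow {a : ℕ} {P : Set Params} {𝒮 : ∀ p, SetSystem p}
    {s : Params → ℕ} (h : EnumerableInSpace a P 𝒮 s) (β : Params → ℕ) :
    EnumerableBelow β a P 𝒮 s := by
  obtain ⟨T, hT⟩ := h
  refine ⟨T, fun p hp => ?_⟩
  obtain ⟨L, h₁, h₂, h₃, h₄⟩ := hT p hp
  exact ⟨L, h₁, h₂, h₃, fun i j _ _ => h₄ i j⟩

theorem EnumerableBelow.mono {β : Params → ℕ} {a : ℕ} {P : Set Params} {𝒮 : ∀ p, SetSystem p}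
    {s s' : Params → ℕ} (h : EnumerableBelow β a P 𝒮 s) (hs : ∀ p ∈ P, s p ≤ s' p) :
    EnumerableBelow β a P 𝒮 s' := by
  obtain ⟨T, hT⟩ := h
  refine ⟨T, fun p hp => ?_⟩
  obtain ⟨L, h₁, h₂, h₃, h₄⟩ := hT p hp
  exact ⟨L, h₁, h₂, h₃, fun i j hi hj => (h₄ i j hi hj).mono (hs p hp)⟩

/-- Filtering every list keeps the number of lists and the absence of repetitions. The inner queries
have indices `v ≤ l.length < 2 ^ p.k`, so `p.k ≤ β p` keeps them within the range where `T` is known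
to answer. -/
theorem EnumerableBelow.con {α : ℚ} (hα : 0 < α) {β : Params → ℕ} {a : ℕ} {P : Set Params}
    {𝒮 : ∀ p, SetSystem p} {G : ∀ p, Graph p} {s q : Params → ℕ}
    (hP : ∀ p ∈ P, p.k ≤ β p ∧ ∀ S ∈ 𝒮 p, S.card < 2 ^ p.k)
    (h : EnumerableBelow β a P 𝒮 s) (hG : ComputableInSpace P G q) :
    EnumerableBelow β a P (fun p => Con α (G p) (𝒮 p))
      fun p => max (s p) (q p) + stepSpace α p (β p) := by
  obtain ⟨T, hT⟩ := h
  obtain ⟨U, hU⟩ := hG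
  refine ⟨stepMachine T U α, fun p hp => ?_⟩
  obtain ⟨L, h₁, h₂, h₃, h₄⟩ := hT p hp
  obtain ⟨hk, hcard⟩ := hP p hp
  set f : List (Str p.n) → List (Str p.n) := fun l =>
    l.filter fun x => decide (allAbove (G p) l (clotThreshold α p) x) with hf
  refine ⟨L.map f, by simpa using h₁, ?_, ?_, fun i j hi hj => ?_⟩
  · simp only [List.mem_map]
    rintro _ ⟨l, hl, rfl⟩
    exact (h₂ l hl).filter _
  · ext S
    simp only [Con, h₃, Set.mem_ofPred_eq, List.mem_map]
    constructor
    · rintro ⟨_, ⟨l, hl, rfl⟩, rfl⟩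
      exact ⟨_, ⟨l, hl, rfl⟩, (toFinset_filter_allAbove hα _ (h₂ l hl)).symm⟩
    · rintro ⟨_, ⟨l, hl, rfl⟩, rfl⟩
      exact ⟨_, ⟨l, hl, rfl⟩, toFinset_filter_allAbove hα _ (h₂ l hl)⟩
  · have hlen : ∀ l ∈ L, l.length < 2 ^ p.k := fun l hl => by
      rw [← List.toFinset_card_of_nodup (h₂ l hl)]
      exact hcard _ (by rw [h₃]; exact ⟨l, hl, rfl⟩)
    -- If `i` is out of range, `T` answers as it would for an empty list, so `l = []` covers this
    -- case too.
    obtain ⟨l, hl, hl₁, hl₂⟩ : ∃ l : List (Str p.n), l.length < 2 ^ p.k ∧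
        (∀ v : ℕ, (L[i]?.bind fun l => l[v]?) = l[v]?) ∧
        ((L.map f)[i]?.bind fun l => l[j]?) = (f l)[j]? := by
      cases hLi : L[i]? with
      | none => exact ⟨[], by positivity, by simp, by simp [hf, hLi]⟩
      | some l => exact ⟨l, hlen l (List.mem_of_getElem? hLi), by simp, by simp [hLi]⟩
    rw [hl₂]
    refine stepMachine_computesInSpace hα hl hi hj (fun v hv => ?_)
      fun x e => (hU p hp x e).mono (le_max_right _ _)
    rw [← hl₁]
    exact (h₄ i v hi ((length_bits_le.2 (by omega)).trans hk)).mono (le_max_left _ _)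

theorem card_lt_of_mem_con {α : ℚ} {p : Params} {G : Graph p} {𝒮 : SetSystem p} {c : ℕ}
    (h : ∀ S ∈ 𝒮, S.card < c) : ∀ S ∈ Con α G 𝒮, S.card < c := by
  rintro _ ⟨S, hS, rfl⟩
  classical
  unfold congested
  exact (Finset.card_filter_le _ _).trans_lt (h S hS)

theorem card_lt_of_mem_iterate_con {α : ℚ} {p : Params} {G : Graph p} {𝒮 : SetSystem p} {c : ℕ}
    (h : ∀ S ∈ 𝒮, S.card < c) (r : ℕ) : ∀ S ∈ (Con α G)^[r] 𝒮, S.card < c := by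
  induction r with
  | zero => exact h
  | succ r ih => rw [iterate_succ_apply']; exact card_lt_of_mem_con ih

/-- Each level takes the maximum with `q p` and then adds `stepSpace`; since `q p` is already below
the first summand, only the overhead accumulates. -/
theorem EnumerableBelow.iterate_con {α : ℚ} (hα : 0 < α) {β : Params → ℕ} {a : ℕ} {P : Set Params}
    {𝒮 : ∀ p, SetSystem p} {G : ∀ p, Graph p} {s q : Params → ℕ}
    (hP : ∀ p ∈ P, p.k ≤ β p ∧ ∀ S ∈ 𝒮 p, S.card < 2 ^ p.k)
    (h : EnumerableBelow β a P 𝒮 s) (hG : ComputableInSpace P G q) (r : ℕ) :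
    EnumerableBelow β a P (fun p => (Con α (G p))^[r] (𝒮 p))
      fun p => max (s p) (q p) + r * stepSpace α p (β p) := by
  induction r with
  | zero => exact h.mono fun p _ => by simp
  | succ r ih =>
    have := ih.con hα (fun p hp => ⟨(hP p hp).1, card_lt_of_mem_iterate_con (hP p hp).2 r⟩) hG
    simp only [iterate_succ_apply']
    refine this.mono fun p _ => ?_
    rw [Nat.succ_mul]
    have := le_max_right (s p) (q p)
    omega

namespace Frag

variable {K E : Type} [DecidableEq K] [Fintype K] {B : ℕ} {S : K → List Bool}

/-! ### Reading and writing short stacks -/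

/-- Empty the stack `k`, which has at most `b` symbols, and go on depending on its contents. -/
def readStack (k : K) : ℕ → (List Bool → Frag K E) → Frag K E
  | 0, cont => cont []
  | b + 1, cont => (pop k).bind fun o => o.elim (cont []) fun x =>
      readStack k b fun l => cont (x :: l)

theorem wp_readStack {k : K} {b : ℕ} {cont : List Bool → Frag K E}
    {post : E → (K → List Bool) → Prop} (hk : (S k).length ≤ b) (hc : cells S ≤ B)
    (h : (cont (S k)).wp B (update S k []) post) : (readStack k b cont).wp B S post := by
  induction b generalizing S cont with
  | zero =>
    have hk : S k = [] := List.eq_nil_of_length_eq_zero (by omega)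
    rw [update_nil hk, hk] at h
    exact h
  | succ b ih =>
    refine wp_bind (wp_pop hc ?_)
    cases hl : S k with
    | nil =>
      rw [hl] at h
      exact h
    | cons x l =>
      rw [hl, List.length_cons] at hk
      refine ih (by simpa using by omega) ?_ ?_
      · have := cells_update S k l
        simp only [hl, List.length_cons, List.tail_cons] at this ⊢
        omega
      · rw [update_self, update_idem, List.tail_cons, ← hl]
        exact h

/-- The strings read are remembered in the control, which stays finite because of the bound `b`. Any
function of short inputs can thus be tabulated. -/
def readStacks (b : ℕ) : List K → (List (List Bool) → Frag K E) → Frag K E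
  | [], cont => cont []
  | k :: ks, cont => readStack k b fun l => readStacks b ks fun ls => cont (l :: ls)

theorem wp_readStacks {ks : List K} (hks : ks.Nodup) {b : ℕ} {cont : List (List Bool) → Frag K E}
    {post : E → (K → List Bool) → Prop} (hk : ∀ k ∈ ks, (S k).length ≤ b) (hc : cells S ≤ B)
    (h : ∀ S', (∀ k ∈ ks, S' k = []) → (∀ k ∉ ks, S' k = S k) →
      (cont (ks.map S)).wp B S' post) : (readStacks b ks cont).wp B S post := by
  induction ks generalizing S cont with
  | nil => exact h S (by simp) (by simp)
  | cons k ks ih =>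
    rw [List.nodup_cons] at hks
    refine wp_readStack (hk k (by simp)) hc (ih hks.2 (fun j hj => ?_) ?_ fun S' h₁ h₂ => ?_)
    · rw [update_of_ne fun h => hks.1 (by rwa [← h])]
      exact hk j (by simp [hj])
    · have := cells_update S k []
      simp only [List.length_nil] at this
      omega
    · have hm : ks.map (update S k []) = ks.map S := List.map_congr_left fun j hj =>
        update_of_ne (fun h => hks.1 (by rwa [← h])) _ _
      rw [hm]
      refine h S' (fun j hj => ?_) fun j hj => ?_
      · by_cases hjk : j ∈ ks
        · exact h₁ j hjk
        · obtain rfl : j = k := by simpa [hjk] using hj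
          rw [h₂ j hjk, update_self]
      · simp only [List.mem_cons, not_or] at hj
        rw [h₂ j hj.2, update_of_ne hj.1]

def pushAll (k : K) (l : List Bool) : Frag K Unit :=
  l.foldr (fun b F => F.bind fun _ => push k b) (Frag.pure ())

theorem wp_pushAll {k : K} {l : List Bool} {post : Unit → (K → List Bool) → Prop}
    (hc : cells S + l.length ≤ B) (h : post () (update S k (l ++ S k))) :
    (pushAll k l).wp B S post := by
  induction l generalizing post with
  | nil => exact wp_pure (by simpa using h)
  | cons b l ih =>
    rw [List.length_cons] at hc
    refine wp_bind (ih (by omega) (wp_push ?_ ?_))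
    · have := cells_update S k (l ++ S k)
      rw [List.length_append] at this
      omega
    · rw [update_self, update_idem]
      exact h

/-- Test whether the stack `k` has fewer than `b` symbols. -/
def shorter (k : K) : ℕ → Frag K Bool
  | 0 => Frag.pure false
  | b + 1 => (pop k).bind fun o => o.elim (Frag.pure true) fun x =>
      (shorter k b).bind fun t => (push k x).bind fun _ => Frag.pure t

theorem wp_shorter {k : K} {b : ℕ} {post : Bool → (K → List Bool) → Prop} (hc : cells S ≤ B)
    (h : post (decide ((S k).length < b)) S) : (shorter k b).wp B S post := by
  induction b generalizing S post with
  | zero => exact wp_pure (by simpa using h)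
  | succ b ih =>
    refine wp_bind (wp_pop hc ?_)
    cases hl : S k with
    | nil =>
      rw [hl] at h
      refine wp_pure ?_
      simp only [List.tail_nil]
      rw [update_nil hl]
      simpa using h
    | cons x l =>
      have hcu : cells (update S k l) + 1 = cells S := by
        have := cells_update S k l
        rw [hl, List.length_cons] at this
        omega
      refine wp_bind (ih (by simp only [List.tail_cons]; omega)
        (wp_bind (wp_push (by simp only [List.tail_cons]; omega) (wp_pure ?_))))
      rw [update_self, update_idem, List.tail_cons, ← hl, update_eq_self]
      rw [hl] at h
      simpa using h

/-! ### Checking the length of a stack -/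

/-- Move `a` to `b` and remove as many symbols from `c`; fail if `c` has too few symbols. -/
def moveWithin (a b c : K) : Frag K Bool :=
  single (.pop a fun o => o.elim (.goto (Sum.inr true)) fun x => .pop c fun o' =>
    o'.elim (.goto (Sum.inr false)) fun _ => .push b x (.goto (Sum.inl ())))

/-- The cell count never grows. If `c` runs out first, the contents of the three stacks are left
unspecified. -/
theorem wp_moveWithin {a b c : K} (hab : a ≠ b) (hac : a ≠ c) (hbc : b ≠ c)
    {post : Bool → (K → List Bool) → Prop} (hc : cells S ≤ B)
    (h : ∀ S', (∀ k ∉ [a, b, c], S' k = S k) → cells S' ≤ B →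
      ((S a).length ≤ (S c).length → S' a = [] ∧ S' b = (S a).reverse ++ S b) →
      post (decide ((S a).length ≤ (S c).length)) S') :
    (moveWithin a b c).wp B S post := by
  generalize hl : S a = l at h
  induction l generalizing S with
  | nil =>
    refine wp_single hc ?_
    have hnil : update S a [] = S := update_nil hl
    simp only [Instr.exec, hl, List.head?_nil, List.tail_nil, Option.elim_none, Sum.elim_inr, hnil]
    simpa using h S (by simp) hc (fun _ => ⟨hl, rfl⟩)
  | cons x l ih =>
    refine wp_single hc ?_
    have d₁ := cells_update S a l
    rw [hl, List.length_cons] at d₁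
    cases hm : S c with
    | nil =>
      have d₂ := cells_update (update S a l) c []
      simp only [Instr.exec, hl, List.head?_cons, List.tail_cons, Option.elim_some,
        update_of_ne hac.symm, hm, List.head?_nil, List.tail_nil, Option.elim_none, Sum.elim_inr]
      have := h (update (update S a l) c []) (fun k hk => ?_) (by simp at d₂; omega)
        (fun h => by simp [hm] at h)
      · simpa [hm] using this
      · simp only [List.mem_cons, not_or] at hk
        rw [update_of_ne hk.2.2.1, update_of_ne hk.1]
    | cons y m =>
      have d₂ := cells_update (update S a l) c m
      have d₃ := cells_update (update (update S a l) c m) b (x :: S b)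
      simp only [update_of_ne hac.symm, update_of_ne hab.symm, update_of_ne hbc, hm,
        List.length_cons] at d₂ d₃
      simp only [Instr.exec, hl, List.head?_cons, List.tail_cons, Option.elim_some,
        update_of_ne hac.symm, hm, Sum.elim_inl, update_of_ne hbc, update_of_ne hab.symm]
      refine ih (by omega) ?_ ?_
      · rw [update_of_ne hab, update_of_ne hac, update_self]
      · intro S' h₁ h₂ h₃
        rw [update_of_ne hbc.symm, update_self] at h₃ ⊢
        have := h S' (fun k hk => ?_) h₂ fun h => ?_
        · simpa [hm] using this
        · rw [h₁ k hk]
          simp only [List.mem_cons, not_or] at hk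
          rw [update_of_ne hk.2.1, update_of_ne hk.2.2.1, update_of_ne hk.1]
        · obtain ⟨h₄, h₅⟩ := h₃ (by simpa [hm] using h)
          exact ⟨h₄, by simp [h₅]⟩

/-- Test whether `a` has at most `c` times as many symbols as `r`. -/
def atMost (c : ℕ) (a r bud mov tmp : K) : Frag K Bool :=
  (forAll (List.replicate c ()) fun _ => copyMap id r bud tmp).bind fun _ =>
    (moveWithin a mov bud).bind fun o => if o then
      (move mov a).bind fun _ => (clear bud).bind fun _ => Frag.pure true
    else Frag.pure false

theorem wp_copies {c : ℕ} {r bud tmp : K} (hrb : r ≠ bud) (hrt : r ≠ tmp) (hbt : bud ≠ tmp)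
    {post : Unit → (K → List Bool) → Prop} (ht : S tmp = [])
    (hc : cells S + c * (S r).length ≤ B)
    (h : ∀ l : List Bool, l.length = c * (S r).length + (S bud).length →
      post () (update S bud l)) :
    (forAll (List.replicate c ()) fun _ => copyMap id r bud tmp).wp B S post := by
  induction c generalizing S with
  | zero =>
    have := h (S bud) (by simp)
    rw [update_eq_self] at this
    exact wp_pure this
  | succ c ih =>
    rw [Nat.succ_mul] at hc
    refine wp_bind (wp_copyMap hrb hrt hbt ht (by omega) (ih ?_ ?_ fun l hl => ?_))
    · rw [update_of_ne hbt.symm, ht]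
    · have := cells_update S bud ((S r).map id ++ S bud)
      rw [update_of_ne hrb]
      simp only [List.map_id, List.length_append] at this ⊢
      omega
    · rw [update_idem]
      refine h l ?_
      rw [hl, update_of_ne hrb, update_self, List.map_id, List.length_append, Nat.succ_mul]
      omega

/-- The extra space is the unary budget `c * (S r).length`, however long `a` is; copying `a` would
violate the bound. After a failure `a` is not restored, as only the empty answer remains to be
given. -/
theorem wp_atMost {c : ℕ} {a r bud mov tmp : K} (hnd : [a, r, bud, mov, tmp].Nodup)
    {post : Bool → (K → List Bool) → Prop} (ht : S tmp = []) (hb : S bud = []) (hm : S mov = [])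
    (hc : cells S + c * (S r).length ≤ B)
    (h₁ : (S a).length ≤ c * (S r).length → post true S)
    (h₂ : c * (S r).length < (S a).length → ∀ S', (∀ k ∉ [a, mov, bud], S' k = S k) →
      cells S' ≤ B → post false S') : (atMost c a r bud mov tmp).wp B S post := by
  simp only [List.nodup_cons, List.mem_cons, List.not_mem_nil, or_false, not_or] at hnd
  obtain ⟨⟨har, hab, ham, hat⟩, ⟨hrb, hrm, hrt⟩, ⟨hbm, hbt⟩, hmt, -⟩ := hnd
  refine wp_bind (wp_copies hrb hrt hbt ht hc fun l hl => ?_)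
  rw [hb, List.length_nil, Nat.add_zero] at hl
  have d₁ := cells_update S bud l
  rw [hb, List.length_nil] at d₁
  refine wp_bind (wp_moveWithin ham hab (Ne.symm hbm) (by omega) fun S' e₁ e₂ e₃ => ?_)
  rw [update_self, update_of_ne hab, hl] at e₃ ⊢
  by_cases hle : (S a).length ≤ c * (S r).length
  · obtain ⟨e₄, e₅⟩ := e₃ hle
    rw [update_of_ne (Ne.symm hbm), hm, List.append_nil] at e₅
    simp only [hle, decide_true, if_true]
    have d₂ := cells_update S' mov []
    have d₃ := cells_update (update S' mov []) a ((S' mov).reverse ++ S' a)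
    simp only [update_of_ne ham, List.length_append, List.length_reverse,
      List.length_nil] at d₂ d₃
    refine wp_bind (wp_move (Ne.symm ham) e₂ (wp_bind (wp_clear (by omega) (wp_pure ?_))))
    convert h₁ hle using 1
    funext k
    by_cases hkb : k = bud
    · subst hkb; simp [hb]
    · by_cases hka : k = a
      · subst hka; simp [hab, e₄, e₅]
      · by_cases hkm : k = mov
        · subst hkm; simp [hkb, hka, hm]
        · simp [hkb, hka, hkm, e₁ k (by simp [hkb, hka, hkm])]
  · simp only [hle, decide_false, Bool.false_eq_true, if_false]
    refine wp_pure (h₂ (by omega) S' (fun k hk => ?_) e₂)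
    rw [e₁ k hk, update_of_ne]
    simp only [List.mem_cons, not_or] at hk
    exact hk.2.2.1

end Frag

/-! ### From short indices and large parameters to all queries -/

inductive Aux : Type
  | tmp | bud | mov | out
  deriving DecidableEq

instance : Fintype Aux := ⟨{.tmp, .bud, .mov, .out}, by rintro (_ | _ | _ | _) <;> decide⟩

namespace Frag

abbrev AuxStacks (T : Machine 6) : Type := (Fin 6 ⊕ Aux) ⊕ (Fin 6 ⊕ T.W)

variable {T : Machine 6}

def inpStack (T : Machine 6) (t : Fin 6) : AuxStacks T := Sum.inl (Sum.inl t)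

def auxStack (T : Machine 6) (r : Aux) : AuxStacks T := Sum.inl (Sum.inr r)

/-- Answer a query with indices of at most `c * n` digits by the function `tab` of the input if
`n < n₀`, and by the machine `T` otherwise. -/
noncomputable def dispatch (T : Machine 6) (c n₀ b : ℕ) (tab : List (List Bool) → List Bool) :
    Frag (AuxStacks T) Unit :=
  (atMost c (inpStack T 4) (inpStack T 0) (auxStack T .bud) (auxStack T .mov)
    (auxStack T .tmp)).bind fun o => if o then
      (atMost c (inpStack T 5) (inpStack T 0) (auxStack T .bud) (auxStack T .mov)
        (auxStack T .tmp)).bind fun o' => if o' then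
          (shorter (inpStack T 0) n₀).bind fun o'' => if o'' then
            readStacks b ((List.finRange 6).map (inpStack T)) fun ls =>
              pushAll (auxStack T .out) (tab ls)
          else call T Sum.inr (inpStack T) (auxStack T .out) (auxStack T .tmp)
        else Frag.pure ()
    else Frag.pure ()

theorem wp_dispatch {c n₀ b s : ℕ} {tab : List (List Bool) → List Bool} {p : Params} {i j : ℕ}
    {output : List Bool} {S : AuxStacks T → List Bool} {B : ℕ}
    (hS : S = extend (inpStack T) (inputs p i.bits j.bits) fun _ => [])
    (hB : ∑ t, (inputs p i.bits j.bits t).length + c * p.n ≤ B)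
    (hout : ∑ t, (inputs p i.bits j.bits t).length + output.length ≤ B)
    (hlong : c * p.n < i.bits.length ∨ c * p.n < j.bits.length → output = [])
    (htab : p.n < n₀ → i.bits.length ≤ c * p.n → j.bits.length ≤ c * p.n →
      (∀ t, (inputs p i.bits j.bits t).length ≤ b) ∧
      tab ((List.finRange 6).map (inputs p i.bits j.bits)) = output)
    (hT : n₀ ≤ p.n → i.bits.length ≤ c * p.n → j.bits.length ≤ c * p.n →
      T.ComputesInSpace (inputs p i.bits j.bits) output s ∧
      ∑ t, (inputs p i.bits j.bits t).length + ∑ t, (inputs p i.bits j.bits t).length + s ≤ B) :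
    (dispatch T c n₀ b tab).wp B S fun _ S' => S' (auxStack T .out) = output ∧ cells S' ≤ B := by
  have hinj : Injective (inpStack T) := fun t t' h => by simpa [inpStack] using h
  have hI : ∀ t, S (inpStack T t) = inputs p i.bits j.bits t := fun t => by
    rw [hS, hinj.extend_apply]
  have hA : ∀ r, S (auxStack T r) = [] := fun r => by
    rw [hS, extend_apply' _ _ _ (by simp [inpStack, auxStack])]
  have hM : ∀ x, S (Sum.inr x) = [] := fun x => by
    rw [hS, extend_apply' _ _ _ (by simp [inpStack])]
  have hcS : cells S = ∑ t, (inputs p i.bits j.bits t).length := by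
    unfold cells
    rw [Fintype.sum_sum_type, Fintype.sum_sum_type]
    have h₁ : ∀ t, S (Sum.inl (Sum.inl t)) = inputs p i.bits j.bits t := hI
    have h₂ : ∀ r, S (Sum.inl (Sum.inr r)) = [] := hA
    simp only [h₁, h₂, hM, List.length_nil, Finset.sum_const_zero, Nat.add_zero]
  have hn : (S (inpStack T 0)).length = p.n := by rw [hI]; simp [inputs]
  have h4 : S (inpStack T 4) = i.bits := by rw [hI]; rfl
  have h5 : S (inpStack T 5) = j.bits := by rw [hI]; rfl
  refine wp_bind (wp_atMost (by simp [inpStack, auxStack]) (hA _) (hA _) (hA _)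
    (by rw [hn]; omega) (fun hi => ?_) fun hi S' e₁ e₂ => wp_pure ⟨?_, e₂⟩)
  swap
  · rw [h4, hn] at hi
    rw [e₁ _ (by simp [inpStack, auxStack]), hA, hlong (Or.inl hi)]
  rw [h4, hn] at hi
  refine wp_bind (wp_atMost (by simp [inpStack, auxStack]) (hA _) (hA _) (hA _)
    (by rw [hn]; omega) (fun hj => ?_) fun hj S' e₁ e₂ => wp_pure ⟨?_, e₂⟩)
  swap
  · rw [h5, hn] at hj
    rw [e₁ _ (by simp [inpStack, auxStack]), hA, hlong (Or.inr hj)]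
  rw [h5, hn] at hj
  refine wp_bind (wp_shorter (by omega) ?_)
  rw [hn]
  by_cases hnn : p.n < n₀
  · obtain ⟨hb, ht⟩ := htab hnn hi hj
    simp only [hnn, decide_true, if_true]
    refine wp_readStacks ((List.nodup_finRange 6).map hinj) ?_ (by omega) fun S' e₁ e₂ => ?_
    · simp only [List.mem_map]
      rintro _ ⟨t, -, rfl⟩
      rw [hI]; exact hb t
    have hmap : ((List.finRange 6).map (inpStack T)).map S =
        (List.finRange 6).map (inputs p i.bits j.bits) := by
      rw [List.map_map]
      exact List.map_congr_left fun t _ => hI t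
    rw [hmap, ht]
    have hS' : ∀ k, S' k = [] := by
      rintro ((t | r) | x)
      · exact e₁ _ (List.mem_map.2 ⟨t, List.mem_finRange t, rfl⟩)
      · rw [e₂ _ (by simp [inpStack])]; exact hA r
      · rw [e₂ _ (by simp [inpStack]), hM]
    have hcS' : cells S' = 0 := by simp [cells, hS']
    refine wp_pushAll (by omega) ⟨by simp [hS'], ?_⟩
    have := cells_update S' (auxStack T .out) (output ++ S' (auxStack T .out))
    simp only [hS', List.append_nil, List.length_nil] at this ⊢
    omega
  · obtain ⟨hT, hB'⟩ := hT (by omega) hi hj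
    simp only [hnn, decide_false, Bool.false_eq_true, if_false]
    refine wp_call Sum.inr_injective (by simp [inpStack]) (by simp [auxStack])
      (by simp [auxStack]) (by simp [inpStack, auxStack]) (by simp [auxStack]) (s := s)
      (output := output) ?_ hM (hA _) (hA _) ?_ ⟨update_self _ _ _, ?_⟩
    · simpa only [hI] using hT
    · simp only [hI]; omega
    · have := cells_update S (auxStack T .out) output
      omega

end Frag

/-- The space of `T` has to fit only for `n₀ ≤ p.n`; the added term there pays for the copy of the
input passed to `T`. For smaller `n` a finite table answers, so only the length check and the output
must fit. -/
theorem EnumerableBelow.enumerableInSpace {a n₀ : ℕ} {b : Polynomial ℕ} {P : Set Params}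
    {𝒮 : ∀ p, SetSystem p} {s s' : Params → ℕ} (hb : Admissible b P)
    (hcard : ∀ p ∈ P, ∀ S ∈ 𝒮 p, S.card < 2 ^ p.k)
    (h : EnumerableBelow (fun p => (a + 1) * p.n) a P 𝒮 s)
    (hs : ∀ p ∈ P, n₀ ≤ p.n → s p + (p.n + p.m + p.d + p.k + 2 * ((a + 1) * p.n)) ≤ s' p)
    (hs' : ∀ p ∈ P, (a + 1) * p.n + p.n + 1 ≤ s' p) : EnumerableInSpace a P 𝒮 s' := by
  classical
  obtain ⟨T, hT⟩ := h
  choose! L hL using hT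
  set ans : Params → ℕ → ℕ → List Bool := fun p i j =>
    encodeAnswer ((L p)[i]?.bind fun l => l[j]?) with hans
  -- The table recovers the parameters as lengths of the unary strings and the indices by inverting
  -- `Nat.bits`. It need not be computable, since only finitely many of its values enter the
  -- program.
  set tab : List (List Bool) → List Bool := fun ls =>
    ans ⟨(ls.getD 0 []).length, (ls.getD 1 []).length, (ls.getD 2 []).length,
      (ls.getD 3 []).length⟩ (invFun Nat.bits (ls.getD 4 [])) (invFun Nat.bits (ls.getD 5 []))
    with htab
  have htab' : ∀ p i j, tab ((List.finRange 6).map (inputs p (Nat.bits i) (Nat.bits j))) =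
      ans p i j := by
    intro p i j
    have hl := leftInverse_invFun bits_injective
    simp [htab, List.finRange_succ, inputs, hl i, hl j]
  -- For `p.n < n₀` this bounds all six inputs: `n` and `k` by `n₀`, `m` and `d` by the supremum,
  -- the indices by the last term.
  set b₀ := n₀ + (Finset.range n₀).sup (fun n => b.eval n) + (a + 1) * n₀
  refine ⟨(Frag.dispatch T (a + 1) n₀ b₀ tab).toMachine (Frag.inpStack T)
    (Frag.auxStack T .out), fun p hp => ?_⟩
  obtain ⟨h₁, h₂, h₃, h₄⟩ := hL p hp
  obtain ⟨hkn, hm, hd⟩ := hb p hp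
  refine ⟨L p, h₁, h₂, h₃, fun i j => ?_⟩
  have hspace := hs' p hp
  refine Frag.computesInSpace_toMachine (fun t t' h => by simpa [Frag.inpStack] using h)
    (Frag.wp_dispatch (s := s p) rfl ?_ ?_ ?_ ?_ ?_)
  · omega
  · have : (encodeAnswer ((L p)[i]?.bind fun l => l[j]?)).length ≤ p.n + 1 := by
      cases (L p)[i]?.bind fun l => l[j]? <;> simp [encodeAnswer]
    omega
  · intro hij
    suffices h : ((L p)[i]?.bind fun l => l[j]?) = none by rw [h]; rfl
    rcases hij with hi | hj
    · rw [Nat.size_eq_bits_len, Nat.lt_size] at hi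
      have : 2 ^ (a * p.n) ≤ 2 ^ ((a + 1) * p.n) :=
        Nat.pow_le_pow_right (by norm_num) (Nat.mul_le_mul_right _ (by omega))
      rw [List.getElem?_eq_none (by omega)]; rfl
    -- A listed set has fewer than $2^k$ elements and $k<n$, so such a `j` exceeds every list.
    · rw [Nat.size_eq_bits_len, Nat.lt_size] at hj
      have hle : 2 ^ p.k ≤ 2 ^ ((a + 1) * p.n) :=
        Nat.pow_le_pow_right (by norm_num) (by nlinarith)
      cases hLi : (L p)[i]? with
      | none => rfl
      | some l =>
        have hl := List.mem_of_getElem? hLi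
        have : l.length < 2 ^ p.k := by
          rw [← List.toFinset_card_of_nodup (h₂ l hl)]
          exact hcard p hp _ (by rw [h₃]; exact ⟨l, hl, rfl⟩)
        exact List.getElem?_eq_none (by omega)
  · intro hn hi hj
    refine ⟨fun t => ?_, htab' p i j⟩
    have hbn : b.eval p.n ≤ (Finset.range n₀).sup (fun n => b.eval n) :=
      Finset.le_sup (f := fun n => b.eval n) (Finset.mem_range.2 hn)
    have hmul : (a + 1) * p.n ≤ (a + 1) * n₀ := Nat.mul_le_mul_left _ hn.le
    fin_cases t <;> simp [inputs] <;> omega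
  · intro hn hi hj
    refine ⟨h₄ i j hi hj, ?_⟩
    have hsum : ∑ t, (inputs p i.bits j.bits t).length =
        p.n + p.m + p.d + p.k + i.bits.length + j.bits.length := by
      simp [inputs, Fin.sum_univ_succ]; omega
    have := hs p hp hn
    omega

/-- The additional space that suffices for all iterates. -/
noncomputable def iterateSpace (α : ℚ) (a : ℕ) (b : Polynomial ℕ) : Polynomial ℕ :=
  Polynomial.X * (Polynomial.C (Fintype.card Reg + 10) * (2 * Polynomial.X + 2 * b +
    Polynomial.C (a + 1) * Polynomial.X + Polynomial.C (α.num.natAbs + α.den + 4))) +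
  (2 * Polynomial.X + 2 * b + 2 * (Polynomial.C (a + 1) * Polynomial.X) + 1)

/-- The cutoff `n₀ = r` removes the dependence on `r`: where the nested machine runs, `r ≤ p.n`, so
its overhead is at most `p.n` times `stepSpace`. -/
theorem enumerableInSpace_iterate_con {α : ℚ} (hα : 0 < α) {a : ℕ} {b : Polynomial ℕ}
    {P : Set Params} {𝒮 : ∀ p, SetSystem p} {G : ∀ p, Graph p} {s q : Params → ℕ}
    (hb : Admissible b P) (h𝒮 : Relevant a P 𝒮) (hs : EnumerableInSpace a P 𝒮 s)
    (hG : ComputableInSpace P G q) (r : ℕ) :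
    EnumerableInSpace a P (fun p => (Con α (G p))^[r] (𝒮 p))
      fun p => 1 * max (s p) (q p) + (iterateSpace α a b).eval p.n := by
  have heval : ∀ n, (iterateSpace α a b).eval n =
      n * ((Fintype.card Reg + 10) * (2 * n + 2 * b.eval n + (a + 1) * n +
        (α.num.natAbs + α.den + 4))) +
      (2 * n + 2 * b.eval n + 2 * ((a + 1) * n) + 1) := by
    intro n
    simp only [iterateSpace, Polynomial.eval_add, Polynomial.eval_mul, Polynomial.eval_X,
      Polynomial.eval_C, Polynomial.eval_ofNat, Polynomial.eval_one]
  have hk : ∀ p ∈ P, p.k ≤ (a + 1) * p.n ∧ ∀ S ∈ 𝒮 p, S.card < 2 ^ p.k := fun p hp =>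
    ⟨(hb p hp).1.le.trans (Nat.le_mul_of_pos_left _ (by omega)), (h𝒮 p hp).1⟩
  refine ((hs.enumerableBelow fun p => (a + 1) * p.n).iterate_con hα hk hG r).enumerableInSpace
    (n₀ := r) hb (fun p hp => card_lt_of_mem_iterate_con (hk p hp).2 r) (fun p hp hn => ?_)
    fun p hp => ?_
  · obtain ⟨h₁, h₂, h₃⟩ := hb p hp
    rw [heval]
    have hstep : stepSpace α p ((a + 1) * p.n) ≤ (Fintype.card Reg + 10) *
        (2 * p.n + 2 * b.eval p.n + (a + 1) * p.n + (α.num.natAbs + α.den + 4)) := by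
      refine Nat.mul_le_mul_left _ ?_
      simp only [registerSize]
      omega
    have := Nat.mul_le_mul hn hstep
    omega
  · rw [heval]
    omega

end CongestedEnum

theorem mainTheorem6 (α : ℚ) (hα : 1 < α) (a : ℕ) (b : Polynomial ℕ) :
    ∃ (c : ℕ) (f : Polynomial ℕ),
      ∀ (P : Set CongestedEnum.Params) (𝒮 : ∀ p, CongestedEnum.SetSystem p)
        (G : ∀ p, CongestedEnum.Graph p) (s q : CongestedEnum.Params → ℕ),
        CongestedEnum.Admissible b P →
        CongestedEnum.Relevant a P 𝒮 →
        CongestedEnum.EnumerableInSpace a P 𝒮 s →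
        CongestedEnum.ComputableInSpace P G q →
        CongestedEnum.EnumerableInSpace a P (fun p => CongestedEnum.Con α (G p) (𝒮 p))
            (fun p => c * max (s p) (q p) + f.eval p.n) ∧
          ∀ r : ℕ,
            CongestedEnum.EnumerableInSpace a P
              (fun p => (CongestedEnum.Con α (G p))^[r] (𝒮 p))
              (fun p => c * max (s p) (q p) + f.eval p.n) := by
  refine ⟨1, CongestedEnum.iterateSpace α a b, fun P 𝒮 G s q hb h𝒮 hs hG => ?_⟩
  have h := CongestedEnum.enumerableInSpace_iterate_con (zero_lt_one.trans hα) hb h𝒮 hs hG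
  -- A single application of `Con` is the iterate with `r = 1`.
  exact ⟨h 1, h⟩
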